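/- For every $N\in\mathbb N$ let $\mu_N$ be a Radon (more generally, $\sigma$-finite Borel) measure on $\mathbb R$ and let $\{P^N_k,Q^N_k\}_{k\ge 0}$ be a biorthogonal family, that is, (real- or complex-valued) functions on $\mathbb R$ with $P^N_kQ^N_n\in L^1(\mu_N)$ and $\int P^N_kQ^N_n\,d\mu_N=\delta_{k,n}$ for all $k,n\ge 0$. Let $\Xi_N=(\xi_1,\dots,\xi_N)$ be the corresponding biorthogonal ensemble: random points $\xi_1,\dots,\xi_N$ in $\mathbb R$ forming a determinantal process on $(\mathbb R,\mu_N)$ with correlation kernel $K_N(x,y)=\sum_{k=0}^{N-1}P^N_k(x)Q^N_k(y)$, i.e. whose $n$-point correlation function with respect to $\mu_N$ is $\det[K_N(x_i,x_j)]_{i,j=1}^n$ for every $n$. Write $\Xi_N(f)=\sum_{i=1}^N f(\xi_i)$. Suppose that there are matrices $\mathbf J^{(N)}=(\mathbf J^{(N)}_{ij})_{i,j\ge 0}$ such that, for all $N$, $i\ge 0$ and $x\in\mathbb R$, $$xP^N_i(x)=\sum_{j\ge 0}\mathbf J^{(N)}_{ij}P^N_j(x),$$ and that there is $W>0$, independent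 of $N$, such that $\mathbf J^{(N)}_{ij}=0$ whenever $|i-j|\ge W$. Suppose that there are a strictly increasing sequence $(N_k)_{k}$ of natural numbers and a Laurent polynomial $s(z)=\sum_{m\in\mathbb Z}\widehat s_m z^m$ with real coefficients (finitely many of them non-zero) such that the Laurent matrix $\mathbf L(s)=(\widehat s_{i-j})_{i,j\in\mathbb Z}$ is the right-limit of $\mathbf J^{(N)}$ along $(N_k)$, i.e. $$\lim_{k\to\infty}\mathbf J^{(N_k)}_{N_k+i,\,N_k+j}=\widehat s_{i-j}\qquad\text{for all } i,j\in\mathbb Z.$$ Then, for every polynomial $F$ with real coefficients, $\Xi_N(F)$ is integrable for every $N$, and with $$\widehat{F(s)}_m=\frac1{2\pi i}\oint_{|z|=1}F(s(z))\,z^{-m}\,\frac{dz}{z},\qquad \|F\|_s^2=\sum_{m=1}^\infty m\,\widehat{F(s)}_m\,\widehat{F(s)}_{-m}$$ (a sum with only finitely many non-zero terms), the number $\|F\|_s^2$ is real and non-negative and $$\Xi_{N_k}(F)-\mathbb E\,\Xi_{N_k}(F)\ \Longrightarrow\ \mathcal N\big(0,\|F\|_s^2\big)\qquad\text{in distribution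 as }k\to\infty,$$ where $\mathcal N(0,0)$ denotes the unit mass at $0$. -/

import Mathlib

open MeasureTheory ProbabilityTheory Filter Topology
open scoped ENNReal NNReal Real

namespace BOE

noncomputable section

/-- `{P_k, Q_k}` is a biorthogonal family for the measure `μ` on `ℝ`: all products `P_k Q_n` are
`μ`-integrable and `∫ P_k Q_n dμ = δ_{k,n}`. -/
structure IsBiorthogonalFamily {𝕜 : Type*} [RCLike 𝕜] (μ : Measure ℝ) (P Q : ℕ → ℝ → 𝕜) :
    Prop where
  integrable : ∀ k n : ℕ, Integrable (fun x => P k x * Q n x) μ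
  biorthogonal : ∀ k n : ℕ, ∫ x, P k x * Q n x ∂μ = if k = n then 1 else 0

/-- The kernel `K_N(x, y) = ∑_{k < N} P_k(x) Q_k(y)`. -/
def kernel {𝕜 : Type*} [RCLike 𝕜] (P Q : ℕ → ℝ → 𝕜) (N : ℕ) (x y : ℝ) : 𝕜 :=
  ∑ k ∈ Finset.range N, P k x * Q k y

/-- `ρ` is an `n`-point correlation function, with respect to `μ`, of the point process
`ξ_1, …, ξ_N` on the probability space `(Ω, Pr)`: for every measurable `f ≥ 0`,
`E ∑ f(ξ_{i_1}, …, ξ_{i_n}) = ∫ f ρ dμ^{⊗ n}`,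
the sum being over all `n`-tuples of pairwise distinct indices. -/
def IsCorrelationFunction {Ω : Type*} [MeasurableSpace Ω] (Pr : Measure Ω) {N : ℕ}
    (ξ : Fin N → Ω → ℝ) (μ : Measure ℝ) (n : ℕ) (ρ : (Fin n → ℝ) → ℝ≥0) : Prop :=
  Measurable ρ ∧
  ∀ f : (Fin n → ℝ) → ℝ≥0∞, Measurable f →
    ∫⁻ ω, ∑ e : Fin n ↪ Fin N, f (fun i => ξ (e i) ω) ∂Pr
      = ∫⁻ x, f x * (ρ x : ℝ≥0∞) ∂(Measure.pi fun _ : Fin n => μ)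

/-- The point process `ξ_1, …, ξ_N` is determinantal on `(ℝ, μ)` with correlation kernel `K`: for
every `n` it has the `n`-point correlation function `det [K(x_i, x_j)]` with respect to `μ`
(a function is only determined almost everywhere by being a correlation function). -/
def IsDeterminantal {𝕜 : Type*} [RCLike 𝕜] {Ω : Type*} [MeasurableSpace Ω] (Pr : Measure Ω)
    {N : ℕ} (ξ : Fin N → Ω → ℝ) (μ : Measure ℝ) (K : ℝ → ℝ → 𝕜) : Prop :=
  ∀ n : ℕ, ∃ ρ : (Fin n → ℝ) → ℝ≥0,
    (∀ᵐ x ∂(Measure.pi fun _ : Fin n => μ),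
      (((ρ x : ℝ≥0) : ℝ) : 𝕜) = (Matrix.of fun i j : Fin n => K (x i) (x j)).det) ∧
    IsCorrelationFunction Pr ξ μ n ρ

/-- The random points `ξ_1, …, ξ_N` form a biorthogonal ensemble with reference measure `μ` and
functions `{P_k, Q_k}`. -/
structure IsBiorthogonalEnsemble {𝕜 : Type*} [RCLike 𝕜] {Ω : Type*} [MeasurableSpace Ω]
    (Pr : Measure Ω) {N : ℕ} (ξ : Fin N → Ω → ℝ) (μ : Measure ℝ) (P Q : ℕ → ℝ → 𝕜) : Prop where
  measurable : ∀ i, Measurable (ξ i)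
  family : IsBiorthogonalFamily μ P Q
  determinantal : IsDeterminantal Pr ξ μ (kernel P Q N)

/-- The recurrence relation `x P(x) = J P(x)` for all real `x`, where `P` is the column vector
`(P_0, P_1, …)`. -/
def Recurrence {𝕜 : Type*} [RCLike 𝕜] (P : ℕ → ℝ → 𝕜) (J : Matrix ℕ ℕ 𝕜) : Prop :=
  ∀ (x : ℝ) (i : ℕ), HasSum (fun j : ℕ => J i j * P j x) ((x : 𝕜) * P i x)

/-- `M_{ij} = 0` whenever `|i - j| ≥ W`. -/
def IsBanded {𝕜 : Type*} [RCLike 𝕜] (W : ℕ) (M : Matrix ℕ ℕ 𝕜) : Prop :=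
  ∀ i j : ℕ, (W : ℤ) ≤ |(i : ℤ) - (j : ℤ)| → M i j = 0

/-- `L` is the right-limit of the matrices `M^{(N)}` along `N_k = φ k`: for all integers `i, j`,
`M^{(N_k)}_{N_k + i, N_k + j} → L_{ij}`. As `N_k → ∞`, the indices `N_k + i` and `N_k + j` are
nonnegative for all large `k`; for the remaining `k` the value is irrelevant. -/
def IsRightLimit {𝕜 : Type*} [RCLike 𝕜] (M : ℕ → Matrix ℕ ℕ 𝕜) (φ : ℕ → ℕ)
    (L : Matrix ℤ ℤ 𝕜) : Prop :=
  ∀ i j : ℤ, Tendsto (fun k : ℕ => M (φ k) ((φ k : ℤ) + i).toNat ((φ k : ℤ) + j).toNat) atTop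
    (𝓝 (L i j))

/-- The Laurent matrix `L(s)` with entries `L(s)_{ij} = ŝ_{i - j}`. -/
def laurentMatrix (𝕜 : Type*) [RCLike 𝕜] (s : LaurentPolynomial ℝ) : Matrix ℤ ℤ 𝕜 :=
  Matrix.of fun i j => ((s.coeff (i - j) : ℝ) : 𝕜)

/-- The value `s(z) = ∑_k ŝ_k z^k` of a Laurent polynomial. -/
def laurentEval (s : LaurentPolynomial ℝ) (z : ℂ) : ℂ :=
  s.coeff.sum fun k a => (a : ℂ) * z ^ k

/-- The coefficient `(2πi)⁻¹ ∮_{|z|=1} F(s(z)) z^{-k} dz/z`. -/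
def symbolCoeff (F : Polynomial ℝ) (s : LaurentPolynomial ℝ) (k : ℤ) : ℂ :=
  (2 * (π : ℂ) * Complex.I)⁻¹ *
    ∮ z in C(0, 1), Polynomial.aeval (laurentEval s z) F * z ^ (-k) / z

/-- The linear statistic `Ξ_N(f) = ∑_i f(ξ_i)`. -/
def linearStatistic {Ω : Type*} {N : ℕ} (ξ : Fin N → Ω → ℝ) (f : ℝ → ℝ) (ω : Ω) : ℝ :=
  ∑ i : Fin N, f (ξ i ω)

end

end BOE

/-! The generating series of the moments is a determinant. Multiplication by F in the basis P_k is
an operator A, the transpose of F(J), with the index k written as N + i, so that the ensemble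
occupies the indices -N ≤ i < 0. Andréief's identity turns E exp(tΞ(F)) into D(t), the determinant
of the N × N truncation of e^{tA}. All series in t are formal; only moments are involved.

Let p be the projection onto i < 0 and q = 1 - p. As p e^{tA} p has constant term p, there is
exactly one series Y = Yp with Y p e^{tA} p = q e^{tA} p. Hence A e^{tA} p = (A + AY) p e^{tA} p,
and Jacobi's formula (`derivation_det`) makes D'/D the trace of A + AY over -N ≤ i < 0. The trace of
A is the mean. Y has non-zero rows only at indices ≥ 0, so if A has band w, only the diagonal
entries of AY with -w ≤ i < 0 contribute. Each coefficient of this trace is thus a polynomial in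
entries near the corner and converges along the right-limit (`tendsto_traceCoeff`).

In the limit A is a Laurent operator with symbol f = u + v, u carrying the powers ≥ 0 and v the
negative ones. Wiener–Hopf factorization gives Y = q e^{tu} p e^{-tu} p, and the trace becomes that
of -p v e^{tu} q e^{-tu} p. With d the number operator, counting along antidiagonals turns this into
the (0,0) entry of -v e^{tu}[d, e^{-tu}] = t v [d, u], that is t ∑ m f_m f_{-m}
(`traceCoeff_laurentOp`).

The series Ψ of the centred moments over n! therefore satisfies Ψ' = LΨ with L → σ²t, so its
coefficients tend to those of e^{σ²t²/2}, and the method of moments concludes. The number σ² is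
non-negative as a limit of variances. -/

namespace BOE

open Finset.HasAntidiagonal (antidiagonal mem_antidiagonal)

/-! ### Column-finite matrices over ℤ, bands and the projection onto negative indices -/

section Operators

/-- Column-finite operators on finitely supported sequences indexed by `ℤ`. -/
abbrev Op (𝕜 : Type*) [Field 𝕜] := Module.End 𝕜 (ℤ →₀ 𝕜)

variable {𝕜 : Type*} [Field 𝕜]

noncomputable instance : Ring (Op 𝕜) := inferInstance

noncomputable instance : Algebra 𝕜 (Op 𝕜) := inferInstance

/-- The matrix entry of an operator. -/
noncomputable def ent (X : Op 𝕜) (i j : ℤ) : 𝕜 := X (Finsupp.single j 1) i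

theorem Op.ext_ent {X Y : Op 𝕜} (h : ∀ i j, ent X i j = ent Y i j) : X = Y := by
  refine Finsupp.lhom_ext' fun j => LinearMap.ext_ring ?_
  ext i
  exact h i j

@[simp] theorem ent_add (X Y : Op 𝕜) (i j : ℤ) : ent (X + Y) i j = ent X i j + ent Y i j := rfl

@[simp] theorem ent_sub (X Y : Op 𝕜) (i j : ℤ) : ent (X - Y) i j = ent X i j - ent Y i j := rfl

@[simp] theorem ent_neg (X : Op 𝕜) (i j : ℤ) : ent (-X) i j = -ent X i j := rfl

@[simp] theorem ent_zero (i j : ℤ) : ent (0 : Op 𝕜) i j = 0 := rfl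

@[simp] theorem ent_smul (c : 𝕜) (X : Op 𝕜) (i j : ℤ) : ent (c • X) i j = c * ent X i j := rfl

theorem ent_one (i j : ℤ) : ent (1 : Op 𝕜) i j = if i = j then 1 else 0 := by
  simp [ent, Finsupp.single_apply, eq_comm]

theorem ent_algebraMap (c : 𝕜) (i j : ℤ) :
    ent (algebraMap 𝕜 (Op 𝕜) c) i j = if i = j then c else 0 := by
  rw [Algebra.algebraMap_eq_smul_one, ent_smul, ent_one]
  simp

theorem ent_sum {ι : Type*} (s : Finset ι) (X : ι → Op 𝕜) (i j : ℤ) :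
    ent (∑ a ∈ s, X a) i j = ∑ a ∈ s, ent (X a) i j := by
  simp [ent, LinearMap.sum_apply, Finsupp.finsetSum_apply]

theorem apply_eq_sum_ent (X : Op 𝕜) (v : ℤ →₀ 𝕜) (i : ℤ) :
    X v i = v.sum fun k c => ent X i k * c := by
  conv_lhs => rw [← Finsupp.sum_single v]
  rw [Finsupp.sum, map_sum, Finsupp.finsetSum_apply]
  refine Finset.sum_congr rfl fun k _ => ?_
  have : Finsupp.single k (v k) = v k • Finsupp.single k (1 : 𝕜) := by simp
  rw [this, map_smul, Finsupp.smul_apply, smul_eq_mul, mul_comm]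
  rfl

/-- Columns are finite, so the product is a sum over the support of a column of `Y`; any `S`
carrying all non-zero terms gives the same value. -/
theorem ent_mul {X Y : Op 𝕜} {i j : ℤ} (S : Finset ℤ)
    (h : ∀ k, k ∉ S → ent X i k * ent Y k j = 0) :
    ent (X * Y) i j = ∑ k ∈ S, ent X i k * ent Y k j := by
  classical
  have h1 : ent (X * Y) i j
      = ∑ k ∈ (Y (Finsupp.single j 1)).support, ent X i k * ent Y k j :=
    apply_eq_sum_ent X (Y (Finsupp.single j 1)) i
  rw [h1, Finset.sum_subset (Finset.subset_union_left (s₂ := S)) (fun k _ hk => ?_),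
    ← Finset.sum_subset (Finset.subset_union_right (s₁ := (Y (Finsupp.single j 1)).support))
      (fun k _ hk => h k hk)]
  have : ent Y k j = 0 := by simpa [ent] using hk
  rw [this, mul_zero]

/-- The operator with given columns. -/
noncomputable def ofCols (c : ℤ → ℤ →₀ 𝕜) : Op 𝕜 := Finsupp.linearCombination 𝕜 c

@[simp] theorem ent_ofCols (c : ℤ → ℤ →₀ 𝕜) (i j : ℤ) : ent (ofCols c) i j = c j i := by
  simp [ent, ofCols]

/-- The projection onto the negative indices. -/
noncomputable def negProj (𝕜 : Type*) [Field 𝕜] : Op 𝕜 :=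
  ofCols fun j => if j < 0 then Finsupp.single j 1 else 0

theorem ent_negProj (i j : ℤ) : ent (negProj 𝕜) i j = if i = j ∧ i < 0 then 1 else 0 := by
  rw [negProj, ent_ofCols]
  by_cases hij : i = j
  · subst hij
    by_cases h : i < 0 <;> simp [h]
  · by_cases h : j < 0 <;> simp [h, hij]

theorem ent_negProj_mul (X : Op 𝕜) (i j : ℤ) :
    ent (negProj 𝕜 * X) i j = if i < 0 then ent X i j else 0 := by
  rw [ent_mul {i}]
  · rw [Finset.sum_singleton, ent_negProj]
    by_cases h : i < 0 <;> simp [h]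
  · intro k hk
    have : i ≠ k := fun h => hk (by simp [h])
    simp [ent_negProj, this]

theorem ent_mul_negProj (X : Op 𝕜) (i j : ℤ) :
    ent (X * negProj 𝕜) i j = if j < 0 then ent X i j else 0 := by
  rw [ent_mul {j}]
  · rw [Finset.sum_singleton, ent_negProj]
    by_cases h : j < 0 <;> simp [h]
  · intro k hk
    have : k ≠ j := fun h => hk (by simp [h])
    simp [ent_negProj, this]

theorem negProj_mul_self : negProj 𝕜 * negProj 𝕜 = negProj 𝕜 := by
  refine Op.ext_ent fun i j => ?_
  rw [ent_negProj_mul, ent_negProj]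
  by_cases h : i < 0 <;> simp [h]

theorem ent_posProj_mul (X : Op 𝕜) (i j : ℤ) :
    ent ((1 - negProj 𝕜) * X) i j = if i < 0 then 0 else ent X i j := by
  rw [sub_mul, one_mul, ent_sub, ent_negProj_mul]
  by_cases h : i < 0 <;> simp [h]

theorem ent_mul_posProj (X : Op 𝕜) (i j : ℤ) :
    ent (X * (1 - negProj 𝕜)) i j = if j < 0 then 0 else ent X i j := by
  rw [mul_sub, mul_one, ent_sub, ent_mul_negProj]
  by_cases h : j < 0 <;> simp [h]

/-- The entries vanish at distance at least `w` from the diagonal. -/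
def HasBand (w : ℤ) (X : Op 𝕜) : Prop := ∀ i j, w ≤ |i - j| → ent X i j = 0

theorem HasBand.mono {w w' : ℤ} {X : Op 𝕜} (h : HasBand w X) (hw : w ≤ w') : HasBand w' X :=
  fun i j hij => h i j (hw.trans hij)

theorem hasBand_negProj : HasBand 1 (negProj 𝕜) := by
  intro i j h
  have : i ≠ j := by rintro rfl; simp at h
  simp [ent_negProj, this]

theorem HasBand.add {w w' : ℤ} {X Y : Op 𝕜} (hX : HasBand w X) (hY : HasBand w' Y) :
    HasBand (max w w') (X + Y) := by
  intro i j h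
  rw [ent_add, hX i j ((le_max_left _ _).trans h), hY i j ((le_max_right _ _).trans h), add_zero]

theorem HasBand.ent_mul {w : ℤ} {X : Op 𝕜} (hX : HasBand w X) (Y : Op 𝕜) (i j : ℤ) :
    ent (X * Y) i j = ∑ k ∈ Finset.Ioo (i - w) (i + w), ent X i k * ent Y k j := by
  refine BOE.ent_mul _ fun k hk => ?_
  rw [hX i k, zero_mul]
  simp only [Finset.mem_Ioo, not_and_or, not_lt] at hk
  rw [le_abs]
  omega

theorem HasBand.mul {w w' : ℤ} {X Y : Op 𝕜} (hX : HasBand w X) (hY : HasBand w' Y) :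
    HasBand (w + w') (X * Y) := by
  intro i j h
  rw [hX.ent_mul]
  refine Finset.sum_eq_zero fun k hk => ?_
  rw [hY k j, mul_zero]
  simp only [Finset.mem_Ioo] at hk
  rw [le_abs] at h ⊢
  omega

/-- The operators whose entries vanish when the row index is at least `-N` and the column index is
smaller than `-N`. -/
def lowerBlock (𝕜 : Type*) [Field 𝕜] (N : ℤ) : Subalgebra 𝕜 (Op 𝕜) where
  carrier := {X | ∀ i j, -N ≤ i → j < -N → ent X i j = 0}
  mul_mem' := by
    classical
    intro X Y hX hY i j hi hj
    rw [ent_mul (Y (Finsupp.single j 1)).support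
      (fun k hk => by rw [show ent Y k j = 0 by simpa [ent] using hk, mul_zero])]
    refine Finset.sum_eq_zero fun k _ => ?_
    by_cases hk : -N ≤ k
    · rw [hY k j hk hj, mul_zero]
    · rw [hX i k hi (by omega), zero_mul]
  add_mem' := by
    intro X Y hX hY i j hi hj
    rw [ent_add, hX i j hi hj, hY i j hi hj, add_zero]
  algebraMap_mem' := by
    intro c i j hi hj
    rw [ent_algebraMap, if_neg (by omega)]

theorem mem_lowerBlock {N : ℤ} {X : Op 𝕜} :
    X ∈ lowerBlock 𝕜 N ↔ ∀ i j, -N ≤ i → j < -N → ent X i j = 0 := Iff.rfl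

theorem negProj_mem_lowerBlock (N : ℤ) : negProj 𝕜 ∈ lowerBlock 𝕜 N := by
  intro i j hi hj
  rw [ent_negProj, if_neg (by omega)]

end Operators

/-! ### Entrywise convergence under a uniform band -/

section Convergence

variable {𝕜 : Type*} [RCLike 𝕜]

/-- Sequences of operators together with a limit operator such that all bands are uniformly
bounded and the entries converge. -/
def convSubalgebra (𝕜 : Type*) [RCLike 𝕜] : Subalgebra 𝕜 ((ℕ → Op 𝕜) × Op 𝕜) where
  carrier := {Z | (∃ w, (∀ k, HasBand w (Z.1 k)) ∧ HasBand w Z.2) ∧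
    ∀ i j, Tendsto (fun k => ent (Z.1 k) i j) atTop (𝓝 (ent Z.2 i j))}
  mul_mem' := by
    rintro X Y ⟨⟨w, hX, hX'⟩, hXt⟩ ⟨⟨w', hY, hY'⟩, hYt⟩
    refine ⟨⟨w + w', fun k => (hX k).mul (hY k), hX'.mul hY'⟩, fun i j => ?_⟩
    -- The uniform band makes the range of summation independent of k, so entrywise limits pass
    -- through products.
    have h1 : ∀ k, ent ((X * Y).1 k) i j
        = ∑ l ∈ Finset.Ioo (i - w) (i + w), ent (X.1 k) i l * ent (Y.1 k) l j :=
      fun k => (hX k).ent_mul _ _ _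
    have h2 : ent ((X * Y).2) i j
        = ∑ l ∈ Finset.Ioo (i - w) (i + w), ent X.2 i l * ent Y.2 l j := hX'.ent_mul _ _ _
    simp only [h1, h2]
    exact tendsto_finsetSum _ fun l _ => (hXt i l).mul (hYt l j)
  add_mem' := by
    rintro X Y ⟨⟨w, hX, hX'⟩, hXt⟩ ⟨⟨w', hY, hY'⟩, hYt⟩
    exact ⟨⟨max w w', fun k => (hX k).add (hY k), hX'.add hY'⟩, fun i j => (hXt i j).add (hYt i j)⟩
  algebraMap_mem' := by
    intro c
    have h : HasBand 1 (algebraMap 𝕜 (Op 𝕜) c) := by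
      intro i j hij
      rw [ent_algebraMap, if_neg (by rintro rfl; simp at hij)]
    exact ⟨⟨1, fun _ => h, h⟩, fun i j => tendsto_const_nhds⟩

theorem mem_convSubalgebra {Z : (ℕ → Op 𝕜) × Op 𝕜} :
    Z ∈ convSubalgebra 𝕜 ↔ (∃ w, (∀ k, HasBand w (Z.1 k)) ∧ HasBand w Z.2) ∧
      ∀ i j, Tendsto (fun k => ent (Z.1 k) i j) atTop (𝓝 (ent Z.2 i j)) := Iff.rfl

theorem const_mem_convSubalgebra {X : Op 𝕜} {w : ℤ} (hX : HasBand w X) :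
    ((fun _ => X, X) : (ℕ → Op 𝕜) × Op 𝕜) ∈ convSubalgebra 𝕜 :=
  ⟨⟨w, fun _ => hX, hX⟩, fun _ _ => tendsto_const_nhds⟩

end Convergence

/-! ### Formal exponential series in an algebra -/

section ExpSeries

/-- The coefficients `a ^ n / n!` of the exponential series of `a`. -/
noncomputable def expCoeff (𝕜 : Type*) {R : Type*} [Field 𝕜] [Ring R] [Algebra 𝕜 R] (a : R)
    (n : ℕ) : R :=
  ((n.factorial : 𝕜)⁻¹) • a ^ n

variable {𝕜 : Type*} {R : Type*} [Field 𝕜] [Ring R] [Algebra 𝕜 R]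

@[simp] theorem expCoeff_zero (a : R) : expCoeff 𝕜 a 0 = 1 := by simp [expCoeff]

theorem map_expCoeff {R' : Type*} [Ring R'] [Algebra 𝕜 R'] (f : R →ₐ[𝕜] R') (a : R) (n : ℕ) :
    f (expCoeff 𝕜 a n) = expCoeff 𝕜 (f a) n := by
  simp [expCoeff]

variable [CharZero 𝕜]

/-- Coefficient form of (e^{ta})' = a e^{ta}. -/
theorem succ_smul_expCoeff_succ (a : R) (n : ℕ) :
    ((n + 1 : ℕ) : 𝕜) • expCoeff 𝕜 a (n + 1) = a * expCoeff 𝕜 a n := by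
  have h1 : ((n : 𝕜) + 1) ≠ 0 := by exact_mod_cast Nat.succ_ne_zero n
  rw [expCoeff, expCoeff, smul_smul, pow_succ', mul_smul_comm, Nat.factorial_succ]
  congr 1
  push_cast
  field_simp

theorem expCoeff_add {a b : R} (h : Commute a b) (n : ℕ) :
    expCoeff 𝕜 (a + b) n
      = ∑ x ∈ antidiagonal n, expCoeff 𝕜 a x.1 * expCoeff 𝕜 b x.2 := by
  rw [expCoeff, h.add_pow', Finset.smul_sum]
  refine Finset.sum_congr rfl fun x hx => ?_
  rw [mem_antidiagonal] at hx
  rw [expCoeff, expCoeff, smul_mul_smul_comm, ← hx, ← Nat.cast_smul_eq_nsmul 𝕜, smul_smul]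
  congr 1
  have h1 : (x.1.factorial : 𝕜) ≠ 0 := by exact_mod_cast x.1.factorial_ne_zero
  have h2 : (x.2.factorial : 𝕜) ≠ 0 := by exact_mod_cast x.2.factorial_ne_zero
  have h3 : ((x.1 + x.2).factorial : 𝕜) ≠ 0 := by exact_mod_cast (x.1 + x.2).factorial_ne_zero
  have h4 := Nat.add_choose_mul_factorial_mul_factorial x.1 x.2
  rw [← Nat.choose_symm_add] at h4
  have h5 : ((x.1 + x.2).choose x.1 : 𝕜) * x.1.factorial * x.2.factorial
      = (x.1 + x.2).factorial := by exact_mod_cast h4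
  field_simp
  linear_combination h5

theorem sum_expCoeff_mul_expCoeff_neg (a : R) (n : ℕ) :
    ∑ x ∈ antidiagonal n, expCoeff 𝕜 a x.1 * expCoeff 𝕜 (-a) x.2
      = if n = 0 then 1 else 0 := by
  rw [← expCoeff_add (Commute.neg_right (Commute.refl a)), add_neg_cancel]
  rcases n with _ | n <;> simp [expCoeff]

end ExpSeries

/-! ### The transfer series Y with Y p a p = (1 - p) a p -/

section Transfer

variable {R : Type*} [Ring R]

/-- The coefficients of the power series `Y` with `(1 - p) a p = Y p a p`, where `p` is an idempotent
and `a` is a power series with constant term `1`. -/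
def transferCoeff (p : R) (a : ℕ → R) : ℕ → R
  | n => (1 - p) * a n * p - ∑ i : Fin n, transferCoeff p a i * p * a (n - i) * p

theorem transferCoeff_eq (p : R) (a : ℕ → R) (n : ℕ) :
    transferCoeff p a n
      = (1 - p) * a n * p - ∑ i ∈ Finset.range n, transferCoeff p a i * p * a (n - i) * p := by
  rw [transferCoeff, Finset.sum_range]

variable {p : R} {a : ℕ → R}

theorem transferCoeff_mul (hp : p * p = p) (n : ℕ) :
    transferCoeff p a n * p = transferCoeff p a n := by
  rw [transferCoeff_eq, sub_mul, Finset.sum_mul]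
  simp only [mul_assoc, hp]

theorem sum_transferCoeff (hp : p * p = p) (ha : a 0 = 1) (n : ℕ) :
    ∑ x ∈ antidiagonal n, transferCoeff p a x.1 * p * a x.2 * p = (1 - p) * a n * p := by
  rw [Finset.Nat.sum_antidiagonal_eq_sum_range_succ_mk, Finset.sum_range_succ, Nat.sub_self, ha,
    mul_one, transferCoeff_mul hp, transferCoeff_mul hp, transferCoeff_eq p a n]
  abel

/-- Since a has constant term 1, the convolution equation is triangular in z with leading term z n,
so it has one solution. This identifies Y once the Wiener–Hopf formula is guessed. -/
theorem eq_transferCoeff (ha : a 0 = 1) {z : ℕ → R} (hz : ∀ n, z n * p = z n)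
    (h : ∀ n, ∑ x ∈ antidiagonal n, z x.1 * p * a x.2 * p = (1 - p) * a n * p) (n : ℕ) :
    z n = transferCoeff p a n := by
  induction n using Nat.strong_induction_on with
  | _ n ih =>
    have h1 := h n
    rw [Finset.Nat.sum_antidiagonal_eq_sum_range_succ_mk, Finset.sum_range_succ, Nat.sub_self, ha,
      mul_one, hz, hz] at h1
    rw [transferCoeff_eq, ← h1, eq_sub_iff_add_eq, add_comm, add_left_inj]
    exact Finset.sum_congr rfl fun i hi => by rw [ih i (Finset.mem_range.1 hi)]

/-- Each coefficient of Y is a non-commutative polynomial in p and the a n. This carries the block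
structure and the convergence of entries over to Y. -/
theorem transferCoeff_mem {𝕜 : Type*} [Field 𝕜] [Algebra 𝕜 R] {S : Subalgebra 𝕜 R} (hp : p ∈ S)
    (ha : ∀ n, a n ∈ S) (n : ℕ) : transferCoeff p a n ∈ S := by
  induction n using Nat.strong_induction_on with
  | _ n ih =>
    rw [transferCoeff_eq]
    refine S.sub_mem (S.mul_mem (S.mul_mem (S.sub_mem S.one_mem hp) (ha n)) hp)
      (S.sum_mem fun i hi => ?_)
    exact S.mul_mem (S.mul_mem (S.mul_mem (ih i (Finset.mem_range.1 hi)) hp) (ha _)) hp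

theorem map_transferCoeff {R' : Type*} [Ring R'] (f : R →+* R') (n : ℕ) :
    f (transferCoeff p a n) = transferCoeff (f p) (fun n => f (a n)) n := by
  induction n using Nat.strong_induction_on with
  | _ n ih =>
    rw [transferCoeff_eq, transferCoeff_eq, map_sub, map_sum]
    simp only [map_mul, map_sub, map_one]
    congr 1
    exact Finset.sum_congr rfl fun i hi => by rw [ih i (Finset.mem_range.1 hi)]

end Transfer

/-! ### Jacobi's formula through dual numbers -/

section DetDerivation

variable {R A : Type*} [CommRing R] [CommRing A] [Algebra R A]

/-- The ring homomorphism `x ↦ x + ε D x` into the dual numbers. -/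
def dualNumberHom (D : Derivation R A A) : A →+* DualNumber A where
  toFun x := TrivSqZeroExt.inl x + TrivSqZeroExt.inr (D x)
  map_one' := by ext <;> simp
  map_mul' x y := by
    ext <;> simp [mul_comm]
  map_zero' := by ext <;> simp
  map_add' x y := by ext <;> simp

/-- Jacobi's formula for a matrix satisfying a linear differential equation. -/
theorem derivation_det {n : Type*} [Fintype n] [DecidableEq n] (D : Derivation R A A)
    {M C : Matrix n n A} (h : ∀ i j, D (M i j) = (C * M) i j) :
    D M.det = C.trace * M.det := by
  -- The hypothesis says that x ↦ x + εDx sends M to (1 + εC)M; since det(1 + εC) = 1 + ε tr C, the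
  -- ε-parts of the determinants give the formula.
  have h1 : (dualNumberHom D).mapMatrix M
      = (1 + (DualNumber.eps : DualNumber A) • (TrivSqZeroExt.inlHom A A).mapMatrix C)
        * (TrivSqZeroExt.inlHom A A).mapMatrix M := by
    rw [add_mul, one_mul, smul_mul_assoc, ← map_mul]
    ext i j
    · simp [dualNumberHom]
    · simp [dualNumberHom, h, Matrix.mul_apply, TrivSqZeroExt.fst_sum]
  have h2 : dualNumberHom D M.det = ((dualNumberHom D).mapMatrix M).det := RingHom.map_det _ _
  rw [h1, Matrix.det_mul, Matrix.det_one_add_smul, ← RingHom.map_det] at h2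
  have h3 := congrArg TrivSqZeroExt.snd h2
  simpa [dualNumberHom, pow_two, Matrix.trace, TrivSqZeroExt.fst_sum, mul_comm] using h3

end DetDerivation

/-! ### The determinant of the truncated exponential -/

section Truncation

variable {𝕜 : Type*} [Field 𝕜]

/-- The projection removes k ≥ 0 and the block condition removes k < -N, so operator products with
`negProj` in the middle become products of N × N matrices. -/
theorem ent_mul_negProj_mul {N : ℕ} {X : Op 𝕜} (hX : X ∈ lowerBlock 𝕜 N) (Y : Op 𝕜) {i : ℤ}
    (hi : -(N : ℤ) ≤ i) (j : ℤ) :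
    ent (X * negProj 𝕜 * Y) i j = ∑ k : Fin N, ent X i (k - N) * ent Y (k - N) j := by
  classical
  rw [mul_assoc, ent_mul (Finset.univ.image fun k : Fin N => (k : ℤ) - N)]
  · rw [Finset.sum_image fun a _ b _ h => Fin.ext (by simpa using h)]
    refine Finset.sum_congr rfl fun k _ => ?_
    have := k.2
    rw [ent_negProj_mul, if_pos (by omega)]
  · intro k hk
    rw [ent_negProj_mul]
    split_ifs with h
    · rw [mem_lowerBlock.1 hX i k hi, zero_mul]
      by_contra hk'
      exact hk (Finset.mem_image.2 ⟨⟨(k + N).toNat, by omega⟩, Finset.mem_univ _, by simp; omega⟩)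
    · rw [mul_zero]

/-- The `N × N` truncation of the power series `e^{tA}`. -/
noncomputable def expTrunc (A : Op 𝕜) (N : ℕ) : Matrix (Fin N) (Fin N) (PowerSeries 𝕜) :=
  Matrix.of fun i j => PowerSeries.mk fun n => ent (expCoeff 𝕜 A n) (i - N) (j - N)

/-- The coefficients of the logarithmic derivative of `e^{tA}` compressed to the negative indices. -/
noncomputable def logDerivCoeff (A : Op 𝕜) (n : ℕ) : Op 𝕜 :=
  (if n = 0 then A else 0) + A * transferCoeff (negProj 𝕜) (expCoeff 𝕜 A) n

/-- Split A e^{tA} p as A p e^{tA} p + A (1 - p) e^{tA} p; the second summand is A Y p e^{tA} p by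
the definition of Y. -/
theorem sum_logDerivCoeff (A : Op 𝕜) (n : ℕ) :
    ∑ x ∈ antidiagonal n, logDerivCoeff A x.1 * negProj 𝕜 * expCoeff 𝕜 A x.2 * negProj 𝕜
      = A * expCoeff 𝕜 A n * negProj 𝕜 := by
  have h1 : ∀ x : ℕ × ℕ, logDerivCoeff A x.1 * negProj 𝕜 * expCoeff 𝕜 A x.2 * negProj 𝕜
      = (if x.1 = 0 then A * negProj 𝕜 * expCoeff 𝕜 A x.2 * negProj 𝕜 else 0)
        + A * (transferCoeff (negProj 𝕜) (expCoeff 𝕜 A) x.1 * negProj 𝕜 * expCoeff 𝕜 A x.2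
          * negProj 𝕜) := by
    intro x
    rw [logDerivCoeff]
    split_ifs
    · noncomm_ring
    · noncomm_ring
  simp only [h1]
  rw [Finset.sum_add_distrib, ← Finset.mul_sum,
    sum_transferCoeff negProj_mul_self (expCoeff_zero A),
    Finset.Nat.sum_antidiagonal_eq_sum_range_succ_mk, Finset.sum_range_succ']
  simp only [Nat.succ_ne_zero, if_false, Finset.sum_const_zero, if_true, Nat.sub_zero]
  noncomm_ring

theorem derivative_expTrunc [CharZero 𝕜] {A : Op 𝕜} {N : ℕ} (hA : A ∈ lowerBlock 𝕜 N)
    (i j : Fin N) :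
    PowerSeries.derivative 𝕜 (expTrunc A N i j)
      = ((Matrix.of fun i j : Fin N =>
          PowerSeries.mk fun n => ent (logDerivCoeff A n) (i - N) (j - N)) * expTrunc A N) i j := by
  have hE : ∀ n, expCoeff 𝕜 A n ∈ lowerBlock 𝕜 N := fun n =>
    Subalgebra.smul_mem _ (Subalgebra.pow_mem _ hA n) _
  have hC : ∀ n, logDerivCoeff A n ∈ lowerBlock 𝕜 N := by
    intro n
    refine Subalgebra.add_mem _ ?_
      (Subalgebra.mul_mem _ hA (transferCoeff_mem (negProj_mem_lowerBlock _) hE n))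
    split_ifs
    exacts [hA, Subalgebra.zero_mem _]
  have hi := i.2
  have hj := j.2
  have hp : ∀ X : Op 𝕜, ent (X * negProj 𝕜) (i - N) (j - N) = ent X (i - N) (j - N) := fun X => by
    rw [ent_mul_negProj, if_pos (by omega)]
  ext n
  rw [PowerSeries.coeff_derivative, Matrix.mul_apply, map_sum]
  simp only [expTrunc, Matrix.of_apply, PowerSeries.coeff_mul, PowerSeries.coeff_mk]
  rw [Finset.sum_comm]
  have h2 : ∀ x : ℕ × ℕ, ∑ k : Fin N, ent (logDerivCoeff A x.1) (i - N) (k - N)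
        * ent (expCoeff 𝕜 A x.2) (k - N) (j - N)
      = ent (logDerivCoeff A x.1 * negProj 𝕜 * expCoeff 𝕜 A x.2 * negProj 𝕜) (i - N) (j - N) := by
    intro x
    rw [hp, ent_mul_negProj_mul (hC _) _ (by omega)]
  simp only [h2]
  rw [← ent_sum, sum_logDerivCoeff, hp, ← succ_smul_expCoeff_succ, ent_smul, mul_comm]
  push_cast
  rfl

/-- The derivative of the determinant of the truncated exponential. -/
theorem derivative_det_expTrunc [CharZero 𝕜] {A : Op 𝕜} {N : ℕ} (hA : A ∈ lowerBlock 𝕜 N) :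
    PowerSeries.derivative 𝕜 (expTrunc A N).det
      = (PowerSeries.mk fun n => ∑ i : Fin N, ent (logDerivCoeff A n) (i - N) (i - N))
        * (expTrunc A N).det := by
  rw [derivation_det (PowerSeries.derivative 𝕜) (derivative_expTrunc hA)]
  congr 1
  ext n
  simp [Matrix.trace]

end Truncation

/-! ### Sums over windows of indices -/

section WindowSums

theorem sum_Ico_neg_zero {M : Type*} [AddCommMonoid M] (K : ℕ) (g : ℤ → M) :
    ∑ i ∈ Finset.Ico (-(K : ℤ)) 0, g i = ∑ a ∈ Finset.range K, g (-((a : ℤ) + 1)) := by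
  refine Finset.sum_bij' (fun i _ => (-i - 1).toNat) (fun a _ => -((a : ℤ) + 1)) ?_ ?_ ?_ ?_ ?_
  · intro i hi
    simp only [Finset.mem_Ico, Finset.mem_range] at hi ⊢
    omega
  · intro a ha
    simp only [Finset.mem_Ico, Finset.mem_range] at ha ⊢
    omega
  · intro i hi
    simp only [Finset.mem_Ico] at hi
    omega
  · intro a ha
    omega
  · intro i hi
    simp only [Finset.mem_Ico] at hi
    congr 1
    omega

theorem sum_Ico_zero {M : Type*} [AddCommMonoid M] (K : ℕ) (g : ℤ → M) :
    ∑ i ∈ Finset.Ico (0 : ℤ) K, g i = ∑ a ∈ Finset.range K, g a := by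
  refine Finset.sum_bij' (fun i _ => i.toNat) (fun a _ => (a : ℤ)) ?_ ?_ ?_ ?_ ?_
  · intro i hi
    simp only [Finset.mem_Ico, Finset.mem_range] at hi ⊢
    omega
  · intro a ha
    simp only [Finset.mem_Ico, Finset.mem_range] at ha ⊢
    omega
  · intro i hi
    simp only [Finset.mem_Ico] at hi
    omega
  · intro a ha
    omega
  · intro i hi
    simp only [Finset.mem_Ico] at hi
    congr 1
    omega

theorem sum_fin_sub {M : Type*} [AddCommMonoid M] (N : ℕ) (g : ℤ → M) :
    ∑ i : Fin N, g (i - N) = ∑ i ∈ Finset.Ico (-(N : ℤ)) 0, g i := by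
  rw [sum_Ico_neg_zero, ← Finset.sum_range_reflect, Fin.sum_univ_eq_sum_range fun i => g (i - N)]
  refine Finset.sum_congr rfl fun i hi => ?_
  rw [Finset.mem_range] at hi
  congr 1
  omega

/-- A given d is a + 1 + b for exactly d pairs (a, b); this is the origin of the weight m in the
variance. -/
theorem sum_sum_hankel {R : Type*} [CommRing R] (K : ℕ) (c : ℕ → R) (hc : ∀ d, K ≤ d → c d = 0) :
    ∑ a ∈ Finset.range K, ∑ b ∈ Finset.range K, c (a + 1 + b)
      = ∑ d ∈ Finset.range K, (d : R) * c d := by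
  have h1 : ∀ a ∈ Finset.range K, ∑ b ∈ Finset.range K, c (a + 1 + b)
      = ∑ d ∈ Finset.Ico (a + 1) K, c d := by
    intro a ha
    rw [Finset.sum_Ico_eq_sum_range]
    refine (Finset.sum_subset (by intro x; simp only [Finset.mem_range]; omega) ?_).symm
    intro x _ hx'
    simp only [Finset.mem_range] at hx'
    exact hc _ (by omega)
  rw [Finset.sum_congr rfl h1,
    Finset.sum_comm' (t' := Finset.range K) (s' := fun d => Finset.range d)]
  · simp
  · intro a d
    simp only [Finset.mem_range, Finset.mem_Ico]
    omega

end WindowSums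

/-! ### Localization of the trace near the corner -/

section Trace

variable {𝕜 : Type*} [Field 𝕜]

/-- The trace, over the window `[-w, 0)`, of the coefficient of `t ^ n` in the logarithmic
derivative of the compressed exponential. -/
noncomputable def traceCoeff (w : ℕ) (A : Op 𝕜) (n : ℕ) : 𝕜 :=
  ∑ i ∈ Finset.Ico (-(w : ℤ)) 0, ent (A * transferCoeff (negProj 𝕜) (expCoeff 𝕜 A) n) i i

theorem ent_transferCoeff_of_neg (a : ℕ → Op 𝕜) (n : ℕ) {i : ℤ} (hi : i < 0) (j : ℤ) :
    ent (transferCoeff (negProj 𝕜) a n) i j = 0 := by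
  induction n using Nat.strong_induction_on generalizing j with
  | _ n ih =>
    rw [transferCoeff_eq, ent_sub, mul_assoc, ent_posProj_mul, if_pos hi, ent_sum, zero_sub,
      neg_eq_zero]
    refine Finset.sum_eq_zero fun k hk => ?_
    rw [mul_assoc, mul_assoc, ent_mul ∅]
    · simp
    · intro l _
      rw [ih k (Finset.mem_range.1 hk) l, zero_mul]

/-- The rows of Y at negative indices vanish, so entry (i, i) of AY needs some k ≥ 0 with |i - k| <
w, which forces i > -w. -/
theorem traceCoeff_of_le {w N : ℕ} {A : Op 𝕜} (hA : HasBand w A) (h : w ≤ N) (n : ℕ) :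
    traceCoeff N A n = traceCoeff w A n := by
  refine (Finset.sum_subset (Finset.Ico_subset_Ico_left (by omega)) fun i hi hi' => ?_).symm
  simp only [Finset.mem_Ico] at hi hi'
  rw [hA.ent_mul]
  refine Finset.sum_eq_zero fun k hk => ?_
  rw [Finset.mem_Ioo] at hk
  rw [ent_transferCoeff_of_neg _ _ (by omega), mul_zero]

theorem sum_ent_logDerivCoeff {w N : ℕ} {A : Op 𝕜} (hA : HasBand w A) (h : w ≤ N) (n : ℕ) :
    ∑ i : Fin N, ent (logDerivCoeff A n) (i - N) (i - N)
      = (if n = 0 then ∑ i : Fin N, ent A (i - N) (i - N) else 0) + traceCoeff w A n := by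
  rw [← traceCoeff_of_le hA h, traceCoeff, ← sum_fin_sub N fun i =>
    ent (A * transferCoeff (negProj 𝕜) (expCoeff 𝕜 A) n) i i]
  simp only [logDerivCoeff, ent_add, Finset.sum_add_distrib]
  split_ifs <;> simp

theorem tendsto_traceCoeff {𝕜 : Type*} [RCLike 𝕜] {Z : (ℕ → Op 𝕜) × Op 𝕜}
    (hZ : Z ∈ convSubalgebra 𝕜) (w n : ℕ) :
    Tendsto (fun k => traceCoeff w (Z.1 k) n) atTop (𝓝 (traceCoeff w Z.2 n)) := by
  set p : (ℕ → Op 𝕜) × Op 𝕜 := (fun _ => negProj 𝕜, negProj 𝕜) with hp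
  -- The sequence and its limit are treated as one element of a product algebra; the homomorphisms
  -- onto the factors then recover each component of AY.
  have h1 : Z * transferCoeff p (expCoeff 𝕜 Z) n ∈ convSubalgebra 𝕜 :=
    Subalgebra.mul_mem _ hZ (transferCoeff_mem (const_mem_convSubalgebra hasBand_negProj)
      (fun n => Subalgebra.smul_mem _ (Subalgebra.pow_mem _ hZ n) _) n)
  have h2 := h1.2
  have e1 : ∀ k, (Z * transferCoeff p (expCoeff 𝕜 Z) n).1 k
      = Z.1 k * transferCoeff (negProj 𝕜) (expCoeff 𝕜 (Z.1 k)) n := fun k => by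
    have := map_transferCoeff (p := p) (a := expCoeff 𝕜 Z)
      ((Pi.evalRingHom (fun _ : ℕ => Op 𝕜) k).comp (RingHom.fst _ _)) n
    exact congrArg (Z.1 k * ·) this
  have e2 : (Z * transferCoeff p (expCoeff 𝕜 Z) n).2
      = Z.2 * transferCoeff (negProj 𝕜) (expCoeff 𝕜 Z.2) n := by
    have := map_transferCoeff (p := p) (a := expCoeff 𝕜 Z) (RingHom.snd _ _) n
    exact congrArg (Z.2 * ·) this
  simp only [e1, e2] at h2
  exact tendsto_finsetSum _ fun i _ => h2 i i

end Trace

/-! ### Wiener–Hopf factorization and commutator identities -/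

section WienerHopf

variable {𝕜 R : Type*} [Field 𝕜] [Ring R] [Algebra 𝕜 R]

/-- The elements `x` with `p x q = 0`, where `p q = 0` and `p + q = 1`. -/
def blockZero (𝕜 : Type*) {R : Type*} [Field 𝕜] [Ring R] [Algebra 𝕜 R] (p q : R)
    (hpq : p * q = 0) (h1 : p + q = 1) : Subalgebra 𝕜 R where
  carrier := {x | p * x * q = 0}
  mul_mem' := by
    intro x y hx hy
    simp only [Set.mem_ofPred_eq] at hx hy ⊢
    calc p * (x * y) * q = p * x * (p + q) * y * q := by rw [h1]; noncomm_ring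
      _ = p * x * (p * y * q) + (p * x * q) * y * q := by noncomm_ring
      _ = 0 := by rw [hx, hy]; simp
  add_mem' := by
    intro x y hx hy
    simp only [Set.mem_ofPred_eq] at hx hy ⊢
    rw [mul_add, add_mul, hx, hy, add_zero]
  algebraMap_mem' := by
    intro c
    simp only [Set.mem_ofPred_eq]
    rw [← Algebra.commutes, mul_assoc, hpq, mul_zero]

theorem expCoeff_block {p q x : R} (hpq : p * q = 0) (h1 : p + q = 1) (hx : p * x * q = 0)
    (n : ℕ) : p * expCoeff 𝕜 x n * q = 0 := by
  have hx' : x ∈ blockZero 𝕜 p q hpq h1 := hx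
  exact Subalgebra.smul_mem _ (Subalgebra.pow_mem _ hx' n) ((n.factorial : 𝕜)⁻¹)

variable [CharZero 𝕜]

/-- Wiener–Hopf factorization of the transfer coefficients. -/
theorem transferCoeff_expCoeff_add {p q u v : R} (hp : p * p = p) (hpq : p * q = 0)
    (hqp : q * p = 0) (h1 : p + q = 1) (huv : Commute u v) (hu : p * u * q = 0)
    (hv : q * v * p = 0) (n : ℕ) :
    transferCoeff p (expCoeff 𝕜 (u + v)) n
      = ∑ x ∈ antidiagonal n, q * expCoeff 𝕜 u x.1 * p * expCoeff 𝕜 (-u) x.2 * p := by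
  have hq : 1 - p = q := by rw [← h1]; abel
  have h1' : q + p = 1 := by rw [add_comm, h1]
  let P : PowerSeries R := PowerSeries.C p
  let Q : PowerSeries R := PowerSeries.C q
  let E : R → PowerSeries R := fun a => PowerSeries.mk (expCoeff 𝕜 a)
  have hPP : P * P = P := by simp only [P]; rw [← map_mul, hp]
  have hPQ : P + Q = 1 := by simp only [P, Q]; rw [← map_add, h1, map_one]
  have hQU : P * E (-u) * Q = 0 := by
    ext m
    have : p * -u * q = 0 := by rw [mul_neg, neg_mul, hu, neg_zero]
    simp [P, Q, E, PowerSeries.coeff_mul_C, PowerSeries.coeff_C_mul,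
      expCoeff_block hpq h1 this]
  have hVP : Q * E v * P = 0 := by
    ext m
    simp [P, Q, E, PowerSeries.coeff_mul_C, PowerSeries.coeff_C_mul,
      expCoeff_block hqp h1' hv]
  have hadd : E (u + v) = E u * E v := by
    ext m
    simp [E, PowerSeries.coeff_mul, expCoeff_add huv]
  have hinv : E (-u) * E u = 1 := by
    ext m
    have := sum_expCoeff_mul_expCoeff_neg (𝕜 := 𝕜) (-u) m
    rw [neg_neg] at this
    simp [E, PowerSeries.coeff_mul, this, PowerSeries.coeff_one]
  -- Since p e^{-tu} q = 0, p e^{-tu} p e^{tu} = p; then q e^{tv} p = 0 allows q e^{tu} p e^{tv} p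
  -- to be replaced by q e^{t(u+v)} p.
  have key : (Q * E u * P * E (-u) * P) * P * E (u + v) * P = Q * E (u + v) * P := by
    calc (Q * E u * P * E (-u) * P) * P * E (u + v) * P
        = Q * E u * (P * E (-u) * (P + Q - Q)) * E u * E v * P := by
          rw [hadd, add_sub_cancel_right]
          simp only [mul_assoc]
          rw [← mul_assoc P P (E u * (E v * P)), hPP]
      _ = Q * E u * P * (E (-u) * E u) * E v * P - Q * E u * (P * E (-u) * Q) * E u * E v * P := by
          rw [hPQ]; noncomm_ring
      _ = Q * E u * (P + Q - Q) * E v * P := by rw [hinv, hQU]; simp [mul_assoc]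
      _ = Q * (E u * E v) * P - Q * E u * (Q * E v * P) := by rw [hPQ]; noncomm_ring
      _ = Q * E (u + v) * P := by rw [hVP, hadd]; simp
  have hco : ∀ m, PowerSeries.coeff m (Q * E u * P * E (-u) * P)
      = ∑ x ∈ antidiagonal m, q * expCoeff 𝕜 u x.1 * p * expCoeff 𝕜 (-u) x.2 * p := by
    intro m
    rw [PowerSeries.coeff_mul_C, PowerSeries.coeff_mul, Finset.sum_mul]
    simp only [Q, P, E, PowerSeries.coeff_mul_C, PowerSeries.coeff_C_mul, PowerSeries.coeff_mk]
  refine (eq_transferCoeff (expCoeff_zero _)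
    (z := fun m => ∑ x ∈ antidiagonal m, q * expCoeff 𝕜 u x.1 * p * expCoeff 𝕜 (-u) x.2 * p)
    (fun m => ?_) (fun m => ?_) n).symm
  · simp only [Finset.sum_mul, mul_assoc, hp]
  · have h2 := congrArg (PowerSeries.coeff m) key
    rw [PowerSeries.coeff_mul_C, PowerSeries.coeff_mul, PowerSeries.coeff_mul_C,
      PowerSeries.coeff_C_mul, Finset.sum_mul] at h2
    simp only [P, PowerSeries.coeff_mul_C, hco, E, PowerSeries.coeff_mk] at h2
    simp only [hq]
    simpa only [P, PowerSeries.coeff_mul_C, hco] using h2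

/-- The term in u dies because p u q = 0. In p v q e^{tu} p e^{-tu} p, replacing the inner p by 1 -
q leaves p v q p = 0 minus p v q e^{tu} q e^{-tu} p, and the first q can be dropped because p e^{tu}
q = 0. For Laurent operators the result has a single q between two Laurent factors. -/
theorem block_mul_transferCoeff {p q u v : R} (hp : p * p = p) (hpq : p * q = 0)
    (hqp : q * p = 0) (h1 : p + q = 1) (huv : Commute u v) (hu : p * u * q = 0)
    (hv : q * v * p = 0) (n : ℕ) :
    p * ((u + v) * transferCoeff p (expCoeff 𝕜 (u + v)) n) * p
      = -∑ x ∈ antidiagonal n, p * (v * expCoeff 𝕜 u x.1 * q * expCoeff 𝕜 (-u) x.2) * p := by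
  have hE := fun n => expCoeff_block (𝕜 := 𝕜) hpq h1 hu n
  have hqe : q = 1 - p := by rw [← h1]; abel
  have h2 : ∀ x : ℕ × ℕ,
      p * ((u + v) * (q * expCoeff 𝕜 u x.1 * p * expCoeff 𝕜 (-u) x.2 * p)) * p
      = p * v * q * (expCoeff 𝕜 u x.1 * expCoeff 𝕜 (-u) x.2) * p
        - p * (v * expCoeff 𝕜 u x.1 * q * expCoeff 𝕜 (-u) x.2) * p := by
    intro x
    have h3 := hE x.1
    set a := expCoeff 𝕜 u x.1
    set b := expCoeff 𝕜 (-u) x.2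
    calc p * ((u + v) * (q * a * p * b * p)) * p
        = (p * u * q) * a * p * b * (p * p) + p * v * q * a * p * b * (p * p) := by noncomm_ring
      _ = p * v * q * a * (p + q - q) * b * p := by rw [hu, hp, add_sub_cancel_right]; simp
      _ = p * v * q * (a * b) * p - p * v * (p + q - p) * a * q * b * p := by
          rw [add_sub_cancel_left, h1]; noncomm_ring
      _ = p * v * q * (a * b) * p - p * (v * a * q * b) * p + p * v * (p * a * q) * b * p := by
          rw [h1]; noncomm_ring
      _ = _ := by rw [h3]; simp
  rw [transferCoeff_expCoeff_add hp hpq hqp h1 huv hu hv, Finset.mul_sum, Finset.mul_sum,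
    Finset.sum_mul, Finset.sum_congr rfl fun x _ => h2 x, Finset.sum_sub_distrib, ← Finset.sum_mul,
    ← Finset.mul_sum, sum_expCoeff_mul_expCoeff_neg]
  split_ifs
  · rw [mul_one, mul_assoc _ q p, hqp]; simp
  · simp

theorem commutator_pow {x d : R} (h : Commute (d * x - x * d) x) (n : ℕ) :
    d * x ^ (n + 1) - x ^ (n + 1) * d = (n + 1) • (x ^ n * (d * x - x * d)) := by
  induction n with
  | zero => simp
  | succ n ih =>
    have h2 : (d * x - x * d) * x ^ (n + 1) = x ^ (n + 1) * (d * x - x * d) := h.pow_right _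
    have h3 : d * x ^ (n + 1 + 1) - x ^ (n + 1 + 1) * d
        = (d * x - x * d) * x ^ (n + 1) + x * (d * x ^ (n + 1) - x ^ (n + 1) * d) := by
      rw [pow_succ' x (n + 1)]; noncomm_ring
    rw [h3, h2, ih, mul_smul_comm, ← mul_assoc x (x ^ n), ← pow_succ', succ_nsmul _ (n + 1),
      add_comm]

theorem commutator_expCoeff_succ {x d : R} (h : Commute (d * x - x * d) x) (n : ℕ) :
    d * expCoeff 𝕜 x (n + 1) - expCoeff 𝕜 x (n + 1) * d = expCoeff 𝕜 x n * (d * x - x * d) := by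
  rw [expCoeff, mul_smul_comm, smul_mul_assoc, ← smul_sub, commutator_pow h,
    ← Nat.cast_smul_eq_nsmul 𝕜, smul_smul, expCoeff, smul_mul_assoc, Nat.factorial_succ]
  congr 1
  have h1 : ((n : 𝕜) + 1) ≠ 0 := by exact_mod_cast Nat.succ_ne_zero n
  push_cast
  field_simp

/-- Coefficient form of e^{tx}[d, e^{-tx}] = -t[d, x], valid as [d, x] commutes with x. It explains
why only the power t¹ survives. -/
theorem sum_expCoeff_mul_commutator {x d : R} (h : Commute (d * x - x * d) x) (n : ℕ) :
    ∑ y ∈ antidiagonal n, expCoeff 𝕜 x y.1 * (d * expCoeff 𝕜 (-x) y.2 - expCoeff 𝕜 (-x) y.2 * d)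
      = if n = 1 then -(d * x - x * d) else 0 := by
  rcases n with _ | n
  · simp
  · have h' : Commute (d * -x - -x * d) (-x) := by
      have : d * -x - -x * d = -(d * x - x * d) := by noncomm_ring
      rw [this]
      exact h.neg_left.neg_right
    rw [Finset.Nat.sum_antidiagonal_succ']
    simp only [commutator_expCoeff_succ h', expCoeff_zero]
    simp only [← mul_assoc]
    rw [← Finset.sum_mul, sum_expCoeff_mul_expCoeff_neg]
    rcases n with _ | n
    · simp; noncomm_ring
    · simp

end WienerHopf

/-! ### Laurent operators and the limiting trace -/

section Laurent

variable {𝕜 : Type*} [Field 𝕜]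

/-- Multiplication by a Laurent polynomial, as an operator on its sequence of coefficients. -/
noncomputable def laurentOp (𝕜 : Type*) [Field 𝕜] : LaurentPolynomial 𝕜 →ₐ[𝕜] Op 𝕜 :=
  ((AddMonoidAlgebra.coeffLinearEquiv (M := ℤ) (S := 𝕜) 𝕜).conjAlgEquiv 𝕜).toAlgHom.comp
    (Algebra.lmul 𝕜 (LaurentPolynomial 𝕜))

theorem ent_laurentOp (g : LaurentPolynomial 𝕜) (i j : ℤ) :
    ent (laurentOp 𝕜 g) i j = g.coeff (i - j) := by
  have : ent (laurentOp 𝕜 g) i j = (g * AddMonoidAlgebra.single j 1).coeff i := rfl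
  rw [this, AddMonoidAlgebra.coeff_mul_single_eq_coeff_mul (i - j) fun m _ => by omega, mul_one]

/-- The number operator `e_j ↦ j e_j`. -/
noncomputable def numOp (𝕜 : Type*) [Field 𝕜] : Op 𝕜 := ofCols fun j => Finsupp.single j (j : 𝕜)

theorem ent_numOp_mul (X : Op 𝕜) (i j : ℤ) : ent (numOp 𝕜 * X) i j = i * ent X i j := by
  rw [ent_mul {i}]
  · simp [numOp]
  · intro k hk
    have : i ≠ k := fun h => hk (by simp [h])
    simp [numOp, this]

theorem ent_mul_numOp (X : Op 𝕜) (i j : ℤ) : ent (X * numOp 𝕜) i j = ent X i j * j := by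
  rw [ent_mul {j}]
  · simp [numOp]
  · intro k hk
    have : k ≠ j := fun h => hk (by simp [h])
    simp [numOp, this]

theorem ent_commutator_numOp (X : Op 𝕜) (i j : ℤ) :
    ent (numOp 𝕜 * X - X * numOp 𝕜) i j = (i - j) * ent X i j := by
  rw [ent_sub, ent_numOp_mul, ent_mul_numOp]
  ring

/-- The commutator with the number operator is again a Laurent operator, with coefficients m g_m,
and Laurent operators commute. -/
theorem commute_commutator_numOp (g : LaurentPolynomial 𝕜) :
    Commute (numOp 𝕜 * laurentOp 𝕜 g - laurentOp 𝕜 g * numOp 𝕜) (laurentOp 𝕜 g) := by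
  have h : numOp 𝕜 * laurentOp 𝕜 g - laurentOp 𝕜 g * numOp 𝕜
      = laurentOp 𝕜 (AddMonoidAlgebra.ofCoeff (Finsupp.onFinset g.coeff.support
          (fun m => (m : 𝕜) * g.coeff m) fun m hm => by
            rw [Finsupp.mem_support_iff]; exact right_ne_zero_of_mul hm)) := by
    refine Op.ext_ent fun i j => ?_
    rw [ent_commutator_numOp, ent_laurentOp, ent_laurentOp]
    simp
  rw [h]
  exact (Commute.all _ _).map (laurentOp 𝕜)

theorem exists_coeff_bound (g : LaurentPolynomial 𝕜) :
    ∃ K : ℕ, ∀ m : ℤ, K ≤ |m| → g.coeff m = 0 := by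
  refine ⟨g.coeff.support.sup (fun m => m.natAbs) + 1, fun m hm => ?_⟩
  by_contra h
  have h1 : m.natAbs ≤ g.coeff.support.sup (fun m => m.natAbs) :=
    Finset.le_sup (f := fun m : ℤ => m.natAbs) (Finsupp.mem_support_iff.2 h)
  rw [Int.abs_eq_natAbs] at hm
  omega

theorem ent_laurentOp_mul_commutator (g h : LaurentPolynomial 𝕜) (K : ℕ)
    (hK : ∀ m : ℤ, K ≤ |m| → h.coeff m = 0) (hh : ∀ m : ℤ, m < 0 → h.coeff m = 0) :
    ent (laurentOp 𝕜 g * (numOp 𝕜 * laurentOp 𝕜 h - laurentOp 𝕜 h * numOp 𝕜)) 0 0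
      = ∑ d ∈ Finset.range K, (d : 𝕜) * (g.coeff (-(d : ℤ)) * h.coeff d) := by
  rw [ent_mul (Finset.Ico 0 (K : ℤ)), sum_Ico_zero]
  · refine Finset.sum_congr rfl fun d _ => ?_
    rw [ent_commutator_numOp, ent_laurentOp, ent_laurentOp]
    simp only [zero_sub, sub_zero, Int.cast_natCast, Int.cast_zero]
    ring
  · intro k hk
    rw [ent_commutator_numOp, ent_laurentOp, ent_laurentOp, sub_zero]
    rw [Finset.mem_Ico, not_and_or, not_le, not_lt] at hk
    rcases hk with hk | hk
    · rw [hh k hk]; simp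
    · rw [hK k (hk.trans (le_abs_self k))]; simp

/-- With row -(a + 1) and inner index b ≥ 0 the summand is g_{-(a+1+b)} h_{a+1+b}, which depends on
a + 1 + b only, so `sum_sum_hankel` applies. -/
theorem sum_ent_laurentOp (g h : LaurentPolynomial 𝕜) (K : ℕ)
    (hK : ∀ m : ℤ, K ≤ |m| → h.coeff m = 0) (hh : ∀ m : ℤ, m < 0 → h.coeff m = 0) :
    ∑ i ∈ Finset.Ico (-(K : ℤ)) 0, ent (laurentOp 𝕜 g * (1 - negProj 𝕜) * laurentOp 𝕜 h) i i
      = ent (laurentOp 𝕜 g * (numOp 𝕜 * laurentOp 𝕜 h - laurentOp 𝕜 h * numOp 𝕜)) 0 0 := by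
  rw [ent_laurentOp_mul_commutator g h K hK hh,
    ← sum_sum_hankel K (fun d => g.coeff (-(d : ℤ)) * h.coeff d), sum_Ico_neg_zero]
  · refine Finset.sum_congr rfl fun a _ => ?_
    rw [mul_assoc, ent_mul (Finset.Ico 0 (K : ℤ)), sum_Ico_zero]
    · refine Finset.sum_congr rfl fun b _ => ?_
      rw [ent_posProj_mul, if_neg (by omega), ent_laurentOp, ent_laurentOp]
      congr 2 <;> push_cast <;> ring
    · intro k hk
      rw [ent_posProj_mul]
      split_ifs with hk0
      · rw [mul_zero]
      · rw [ent_laurentOp _ k, hK, mul_zero]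
        rw [Finset.mem_Ico, not_and_or, not_le, not_lt] at hk
        rw [le_abs]
        omega
  · intro d hd
    rw [hK d (by rw [le_abs]; omega), mul_zero]

/-- The second cumulant associated with a Laurent symbol. -/
noncomputable def laurentVariance (f : LaurentPolynomial 𝕜) (K : ℕ) : 𝕜 :=
  ∑ d ∈ Finset.range K, (d : 𝕜) * (f.coeff d * f.coeff (-(d : ℤ)))

theorem exists_laurent_split (f : LaurentPolynomial 𝕜) :
    ∃ u v : LaurentPolynomial 𝕜, u + v = f ∧ (∀ m, u.coeff m = if 0 ≤ m then f.coeff m else 0) ∧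
      ∀ m, v.coeff m = if m < 0 then f.coeff m else 0 := by
  classical
  refine ⟨AddMonoidAlgebra.ofCoeff (f.coeff.filter (0 ≤ ·)),
    AddMonoidAlgebra.ofCoeff (f.coeff.filter (· < 0)), ?_, fun m => ?_, fun m => ?_⟩
  · ext m
    by_cases h : 0 ≤ m
    · simp [h, not_lt.2 h]
    · simp [h, not_le.1 h]
  · simp [Finsupp.filter_apply]
  · simp [Finsupp.filter_apply]

/-- For a Laurent operator only the coefficient of `t` in the logarithmic derivative survives. -/
theorem traceCoeff_laurentOp [CharZero 𝕜] (f : LaurentPolynomial 𝕜) {w : ℕ}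
    (hw : HasBand w (laurentOp 𝕜 f)) (hf : ∀ m : ℤ, w ≤ |m| → f.coeff m = 0) (n : ℕ) :
    traceCoeff w (laurentOp 𝕜 f) n = if n = 1 then laurentVariance f w else 0 := by
  obtain ⟨u, v, huv, hu, hv⟩ := exists_laurent_split f
  set p := negProj 𝕜
  set q : Op 𝕜 := 1 - p with hq
  set U := laurentOp 𝕜 u
  set V := laurentOp 𝕜 v
  have hp : p * p = p := negProj_mul_self
  have hpq : p * q = 0 := by rw [hq, mul_sub, hp, mul_one, sub_self]
  have hqp : q * p = 0 := by rw [hq, sub_mul, hp, one_mul, sub_self]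
  have h1 : p + q = 1 := by rw [hq]; abel
  have hcomm : Commute U V := (Commute.all u v).map (laurentOp 𝕜)
  have hpU : ∀ g : LaurentPolynomial 𝕜, p * laurentOp 𝕜 g * q = 0 ↔
      ∀ m : ℤ, m < 0 → g.coeff m = 0 := by
    intro g
    constructor
    · intro h m hm
      have h2 : ent (p * laurentOp 𝕜 g * q) m 0 = 0 := by rw [h, ent_zero]
      rw [ent_mul_posProj, if_neg (by omega), ent_negProj_mul, if_pos hm, ent_laurentOp,
        sub_zero] at h2
      exact h2
    · intro h
      refine Op.ext_ent fun i j => ?_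
      rw [ent_mul_posProj, ent_negProj_mul, ent_laurentOp, ent_zero]
      split_ifs
      · rfl
      · exact h _ (by omega)
      · rfl
  have hU : p * U * q = 0 := (hpU u).2 fun m hm => by rw [hu, if_neg (by omega)]
  have hV : q * V * p = 0 := by
    refine Op.ext_ent fun i j => ?_
    rw [ent_mul_negProj, ent_posProj_mul, ent_laurentOp, ent_zero]
    split_ifs
    · rfl
    · rw [hv, if_neg (by omega)]
    · rfl
  have hf' : laurentOp 𝕜 f = U + V := by rw [← huv, map_add]
  choose B hB using fun b => exists_coeff_bound (expCoeff 𝕜 (-u) b)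
  -- The window is enlarged beyond the degrees of all coefficients of e^{-tu} up to order n; the
  -- trace is unaffected by `traceCoeff_of_le`.
  set K := max w ((Finset.range (n + 1)).sup B)
  have hBK : ∀ b, b ≤ n → ∀ m : ℤ, K ≤ |m| → (expCoeff 𝕜 (-u) b).coeff m = 0 := by
    intro b hb m hm
    refine hB b m (le_trans ?_ hm)
    have : B b ≤ (Finset.range (n + 1)).sup B :=
      Finset.le_sup (Finset.mem_range.2 (Nat.lt_succ_of_le hb))
    exact_mod_cast this.trans (le_max_right _ _)
  -- Triangular operators are closed under powers; `hpU` translates this back to the support of the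
  -- coefficients.
  have hneg : ∀ b, ∀ m : ℤ, m < 0 → (expCoeff 𝕜 (-u) b).coeff m = 0 := by
    intro b
    rw [← hpU, map_expCoeff, map_neg]
    exact expCoeff_block hpq h1 (by rw [mul_neg, neg_mul, hU, neg_zero]) b
  rw [← traceCoeff_of_le hw (le_max_left w _ : w ≤ K), traceCoeff]
  have h2 : ∀ i ∈ Finset.Ico (-(K : ℤ)) 0,
      ent (laurentOp 𝕜 f * transferCoeff p (expCoeff 𝕜 (laurentOp 𝕜 f)) n) i i
      = -∑ x ∈ antidiagonal n, ent (laurentOp 𝕜 (v * expCoeff 𝕜 u x.1) * q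
          * laurentOp 𝕜 (expCoeff 𝕜 (-u) x.2)) i i := by
    intro i hi
    rw [Finset.mem_Ico] at hi
    have h3 : ∀ X : Op 𝕜, ent (p * X * p) i i = ent X i i := fun X => by
      rw [ent_mul_negProj, if_pos hi.2, ent_negProj_mul, if_pos hi.2]
    rw [hf', ← h3, block_mul_transferCoeff hp hpq hqp h1 hcomm hU hV, ent_neg, ent_sum]
    congr 1
    refine Finset.sum_congr rfl fun x _ => ?_
    rw [h3, map_mul, map_expCoeff, map_expCoeff, map_neg]
  rw [Finset.sum_congr rfl h2, Finset.sum_neg_distrib, Finset.sum_comm]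
  have h4 : ∀ x ∈ antidiagonal n, ∑ i ∈ Finset.Ico (-(K : ℤ)) 0,
      ent (laurentOp 𝕜 (v * expCoeff 𝕜 u x.1) * q * laurentOp 𝕜 (expCoeff 𝕜 (-u) x.2)) i i
      = ent (V * (expCoeff 𝕜 U x.1 * (numOp 𝕜 * expCoeff 𝕜 (-U) x.2
          - expCoeff 𝕜 (-U) x.2 * numOp 𝕜))) 0 0 := by
    intro x hx
    rw [mem_antidiagonal] at hx
    rw [sum_ent_laurentOp _ _ K (hBK _ (by omega)) (hneg _), map_mul, map_expCoeff, map_expCoeff,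
      map_neg, mul_assoc]
  rw [Finset.sum_congr rfl h4, ← ent_sum, ← Finset.mul_sum,
    sum_expCoeff_mul_commutator (commute_commutator_numOp u)]
  split_ifs with hn
  · rw [mul_neg, ent_neg, neg_neg,
      ent_laurentOp_mul_commutator v u w, laurentVariance]
    · refine Finset.sum_congr rfl fun d _ => ?_
      rw [hu, hv, if_pos (Int.natCast_nonneg d)]
      rcases d with _ | d
      · simp
      · rw [if_pos (by omega : -((d + 1 : ℕ) : ℤ) < 0)]; ring
    · intro m hm
      rw [hu, hf m hm, ite_self]
    · intro m hm
      rw [hu, if_neg (by omega)]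
  · simp

end Laurent

/-! ### Scalar exponential series -/

section ExpSeries

variable {𝕜 : Type*} [Field 𝕜]

/-- The exponential series `e^{at}`. -/
noncomputable def expSeries (a : 𝕜) : PowerSeries 𝕜 := PowerSeries.mk (expCoeff 𝕜 a)

@[simp] theorem coeff_expSeries (a : 𝕜) (n : ℕ) :
    PowerSeries.coeff n (expSeries a) = expCoeff 𝕜 a n := PowerSeries.coeff_mk _ _

theorem expSeries_zero : expSeries (0 : 𝕜) = 1 := by
  ext n
  rw [coeff_expSeries, PowerSeries.coeff_one]
  rcases n with _ | n <;> simp [expCoeff]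

variable [CharZero 𝕜]

theorem expSeries_add (a b : 𝕜) : expSeries (a + b) = expSeries a * expSeries b := by
  ext n
  simp [PowerSeries.coeff_mul, expCoeff_add (Commute.all a b)]

theorem expSeries_sum {ι : Type*} (s : Finset ι) (a : ι → 𝕜) :
    expSeries (∑ i ∈ s, a i) = ∏ i ∈ s, expSeries (a i) := by
  classical
  induction s using Finset.induction_on with
  | empty => simp [expSeries_zero]
  | insert i s hi ih => rw [Finset.sum_insert hi, Finset.prod_insert hi, expSeries_add, ih]

end ExpSeries

/-! ### Andréief's identity for formal power series -/

section Andreief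

variable {𝕜 : Type*} [RCLike 𝕜]

theorem det_kernel (P Q : ℕ → ℝ → 𝕜) (N : ℕ) (x : Fin N → ℝ) :
    (Matrix.of fun i j : Fin N => kernel P Q N (x i) (x j)).det
      = ∑ σ : Equiv.Perm (Fin N), ∑ τ : Equiv.Perm (Fin N),
        ((Equiv.Perm.sign σ : ℤ) : 𝕜) * ((Equiv.Perm.sign τ : ℤ) : 𝕜)
          * ∏ i, (P (σ i) (x i) * Q (τ i) (x i)) := by
  have h : (Matrix.of fun i j : Fin N => kernel P Q N (x i) (x j))
      = (Matrix.of fun k i : Fin N => P k (x i)).transpose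
        * (Matrix.of fun k i : Fin N => Q k (x i)) := by
    ext i j
    rw [Matrix.mul_apply, Matrix.of_apply, kernel, Finset.sum_range]
    rfl
  rw [h, Matrix.det_mul, Matrix.det_transpose, Matrix.det_apply', Matrix.det_apply',
    Finset.sum_mul_sum]
  refine Finset.sum_congr rfl fun σ _ => Finset.sum_congr rfl fun τ _ => ?_
  simp only [Matrix.of_apply, Finset.prod_mul_distrib]
  ring

/-- For fixed σ the sum over τ is the determinant with columns permuted by σ; its sign cancels the
sign of σ, so each σ contributes det M. -/
theorem sum_perm_perm_prod {R : Type*} [CommRing R] {N : ℕ} (M : Matrix (Fin N) (Fin N) R) :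
    ∑ σ : Equiv.Perm (Fin N), ∑ τ : Equiv.Perm (Fin N),
        ((Equiv.Perm.sign σ : ℤ) : R) * ((Equiv.Perm.sign τ : ℤ) : R) * ∏ i, M (τ i) (σ i)
      = (N.factorial : R) * M.det := by
  have h : ∀ σ : Equiv.Perm (Fin N), ∑ τ : Equiv.Perm (Fin N),
        ((Equiv.Perm.sign σ : ℤ) : R) * ((Equiv.Perm.sign τ : ℤ) : R) * ∏ i, M (τ i) (σ i)
      = M.det := by
    intro σ
    simp only [mul_assoc]
    rw [← Finset.mul_sum]
    have h1 : ∑ τ : Equiv.Perm (Fin N), ((Equiv.Perm.sign τ : ℤ) : R) * ∏ i, M (τ i) (σ i)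
        = (M.submatrix id σ).det := by
      rw [Matrix.det_apply']
      rfl
    rw [h1, Matrix.det_permute', ← mul_assoc, ← Int.cast_mul, ← Units.val_mul,
      Int.units_mul_self]
    simp
  rw [Finset.sum_congr rfl fun σ _ => h σ]
  simp [Fintype.card_perm]

/-- Andréief's identity for the powers of a linear statistic. -/
theorem integral_det_mul_pow {μ : Measure ℝ} [SigmaFinite μ] {P Q : ℕ → ℝ → 𝕜} (N : ℕ)
    {f : ℝ → 𝕜} (hint : ∀ n (k l : Fin N), Integrable (fun x => f x ^ n * (P k x * Q l x)) μ)
    (n : ℕ) :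
    Integrable (fun x : Fin N → ℝ => (Matrix.of fun i j => kernel P Q N (x i) (x j)).det
      * expCoeff 𝕜 (∑ i, f (x i)) n) (Measure.pi fun _ => μ) ∧
    ∫ x : Fin N → ℝ, (Matrix.of fun i j => kernel P Q N (x i) (x j)).det
      * expCoeff 𝕜 (∑ i, f (x i)) n ∂(Measure.pi fun _ => μ)
      = N.factorial * PowerSeries.coeff n (Matrix.of fun i j : Fin N => PowerSeries.mk fun n =>
          (n.factorial : 𝕜)⁻¹ * ∫ x, f x ^ n * (P j x * Q i x) ∂μ).det := by
  have h1 : ∀ x : Fin N → ℝ, (Matrix.of fun i j => kernel P Q N (x i) (x j)).det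
      * expCoeff 𝕜 (∑ i, f (x i)) n
      = ∑ σ : Equiv.Perm (Fin N), ∑ τ : Equiv.Perm (Fin N),
        ∑ a ∈ Finset.finsuppAntidiag Finset.univ n,
        (((Equiv.Perm.sign σ : ℤ) : 𝕜) * ((Equiv.Perm.sign τ : ℤ) : 𝕜))
          * ∏ i, (((a i).factorial : 𝕜)⁻¹ * (f (x i) ^ a i * (P (σ i) (x i) * Q (τ i) (x i)))) := by
    intro x
    rw [det_kernel, ← coeff_expSeries, expSeries_sum, PowerSeries.coeff_prod, Finset.sum_mul]
    refine Finset.sum_congr rfl fun σ _ => ?_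
    rw [Finset.sum_mul]
    refine Finset.sum_congr rfl fun τ _ => ?_
    rw [Finset.mul_sum]
    refine Finset.sum_congr rfl fun a _ => ?_
    rw [mul_assoc, ← Finset.prod_mul_distrib]
    congr 1
    refine Finset.prod_congr rfl fun i _ => ?_
    rw [coeff_expSeries, expCoeff, smul_eq_mul]
    ring
  have h2 : ∀ (σ τ : Equiv.Perm (Fin N)) (a : Fin N →₀ ℕ), Integrable (fun x : Fin N → ℝ =>
      (((Equiv.Perm.sign σ : ℤ) : 𝕜) * ((Equiv.Perm.sign τ : ℤ) : 𝕜))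
        * ∏ i, (((a i).factorial : 𝕜)⁻¹ * (f (x i) ^ a i * (P (σ i) (x i) * Q (τ i) (x i)))))
      (Measure.pi fun _ => μ) := fun σ τ a =>
    (Integrable.fintype_prod (f := fun i y => ((a i).factorial : 𝕜)⁻¹
      * (f y ^ a i * (P (σ i) y * Q (τ i) y))) fun i => (hint _ _ _).const_mul _).const_mul _
  simp only [h1]
  refine ⟨integrable_finsetSum _ fun σ _ => integrable_finsetSum _ fun τ _ =>
    integrable_finsetSum _ fun a _ => h2 σ τ a, ?_⟩
  rw [integral_finsetSum _ fun σ _ => integrable_finsetSum _ fun τ _ =>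
    integrable_finsetSum _ fun a _ => h2 σ τ a]
  set M : Matrix (Fin N) (Fin N) (PowerSeries 𝕜) := Matrix.of fun i j : Fin N =>
    PowerSeries.mk fun n => (n.factorial : 𝕜)⁻¹ * ∫ x, f x ^ n * (P j x * Q i x) ∂μ with hM
  have h3 : (N.factorial : 𝕜) * PowerSeries.coeff n M.det
      = PowerSeries.coeff n ((N.factorial : PowerSeries 𝕜) * M.det) := by
    rw [← nsmul_eq_mul, ← nsmul_eq_mul, map_nsmul]
  rw [h3, ← sum_perm_perm_prod, map_sum]
  refine Finset.sum_congr rfl fun σ _ => ?_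
  rw [integral_finsetSum _ fun τ _ => integrable_finsetSum _ fun a _ => h2 σ τ a, map_sum]
  refine Finset.sum_congr rfl fun τ _ => ?_
  rw [integral_finsetSum _ fun a _ => h2 σ τ a]
  have h4 : ((Equiv.Perm.sign σ : ℤ) : PowerSeries 𝕜) * ((Equiv.Perm.sign τ : ℤ) : PowerSeries 𝕜)
      = PowerSeries.C (((Equiv.Perm.sign σ : ℤ) : 𝕜) * ((Equiv.Perm.sign τ : ℤ) : 𝕜)) := by
    simp
  rw [h4, PowerSeries.coeff_C_mul, PowerSeries.coeff_prod, Finset.mul_sum]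
  refine Finset.sum_congr rfl fun a _ => ?_
  rw [integral_const_mul, integral_fintype_prod_eq_prod (fun i y => ((a i).factorial : 𝕜)⁻¹
      * (f y ^ a i * (P (σ i) y * Q (τ i) y)))]
  congr 1
  refine Finset.prod_congr rfl fun i _ => ?_
  rw [integral_const_mul, hM, Matrix.of_apply, PowerSeries.coeff_mk]

end Andreief

/-! ### Moments of linear statistics of a determinantal process -/

section Moments

variable {𝕜 : Type*} [RCLike 𝕜] {Ω : Type*} [MeasurableSpace Ω] {Pr : Measure Ω}
  {N : ℕ} {ξ : Fin N → Ω → ℝ} {μ : Measure ℝ}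

/-- Embeddings of `Fin N` into itself are permutations, so the N-point correlation function is the
density of the law of the points summed over all N! orderings. -/
theorem sum_map_eq_withDensity (hξ : ∀ i, Measurable (ξ i)) {ρ : (Fin N → ℝ) → ℝ≥0}
    (h : IsCorrelationFunction Pr ξ μ N ρ) :
    ∑ e : Fin N ↪ Fin N, Pr.map (fun ω i => ξ (e i) ω)
      = (Measure.pi fun _ : Fin N => μ).withDensity fun x => (ρ x : ℝ≥0∞) := by
  have hm : ∀ e : Fin N ↪ Fin N, Measurable fun ω i => ξ (e i) ω := fun e =>
    measurable_pi_lambda _ fun i => hξ (e i)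
  ext s hs
  rw [withDensity_apply _ hs, ← lintegral_indicator hs]
  have h1 := h.2 (s.indicator fun _ => 1) (measurable_const.indicator hs)
  have h2 : ∀ x, s.indicator (fun _ => (1 : ℝ≥0∞)) x * (ρ x : ℝ≥0∞)
      = s.indicator (fun x => (ρ x : ℝ≥0∞)) x := by
    intro x
    by_cases hx : x ∈ s <;> simp [hx]
  simp only [h2] at h1
  have h3 : ∀ e : Fin N ↪ Fin N,
      Measurable fun ω => s.indicator (fun _ => (1 : ℝ≥0∞)) fun i => ξ (e i) ω := fun e =>
    (measurable_const.indicator hs).comp (hm e)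
  rw [← h1, lintegral_finsetSum _ fun e _ => h3 e,
    Measure.finsetSum_apply]
  refine Finset.sum_congr rfl fun e _ => ?_
  rw [Measure.map_apply (hm e) hs, ← lintegral_indicator_one (hm e hs)]
  rfl

/-- Expectations of symmetric functions of the points of a determinantal process. -/
theorem integral_symmetric (hξ : ∀ i, Measurable (ξ i)) {K : ℝ → ℝ → 𝕜}
    (h : IsDeterminantal Pr ξ μ K) {g : (Fin N → ℝ) → ℝ} (hg : Measurable g)
    (hsymm : ∀ (e : Fin N ↪ Fin N) x, g (fun i => x (e i)) = g x)
    (hint : Integrable (fun x => (Matrix.of fun i j : Fin N => K (x i) (x j)).det * (g x : 𝕜))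
      (Measure.pi fun _ => μ)) :
    Integrable (fun ω => g fun i => ξ i ω) Pr ∧
    (N.factorial : 𝕜) * ((∫ ω, g (fun i => ξ i ω) ∂Pr : ℝ) : 𝕜)
      = ∫ x, (Matrix.of fun i j : Fin N => K (x i) (x j)).det * (g x : 𝕜)
        ∂(Measure.pi fun _ => μ) := by
  obtain ⟨ρ, hρ, hcorr⟩ := h N
  have hm : ∀ e : Fin N ↪ Fin N, Measurable fun ω i => ξ (e i) ω := fun e =>
    measurable_pi_lambda _ fun i => hξ (e i)
  have h1 := sum_map_eq_withDensity hξ hcorr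
  have h2 : (fun x => ρ x • (g x : 𝕜)) =ᵐ[Measure.pi fun _ => μ]
      fun x => (Matrix.of fun i j : Fin N => K (x i) (x j)).det * (g x : 𝕜) := by
    filter_upwards [hρ] with x hx
    rw [← hx, NNReal.smul_def, RCLike.real_smul_eq_coe_mul]
  have h3 : Integrable (fun x => (g x : 𝕜))
      ((Measure.pi fun _ : Fin N => μ).withDensity fun x => (ρ x : ℝ≥0∞)) := by
    rw [integrable_withDensity_iff_integrable_smul hcorr.1]
    exact hint.congr h2.symm
  have h4 := integral_withDensity_eq_integral_smul (μ := Measure.pi fun _ : Fin N => μ) hcorr.1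
    (fun x => (g x : 𝕜))
  rw [integral_congr_ae h2, ← h1] at h4
  rw [← h1, integrable_finsetSum_measure] at h3
  have hgm : Measurable fun x => (g x : 𝕜) := RCLike.continuous_ofReal.measurable.comp hg
  have h5 : Integrable (fun ω => g fun i => ξ i ω) Pr := by
    have h6 := h3 (Function.Embedding.refl _) (Finset.mem_univ _)
    rw [integrable_map_measure hgm.aestronglyMeasurable (hm _).aemeasurable] at h6
    simpa [Function.comp_def] using h6.re
  refine ⟨h5, ?_⟩
  rw [← h4, integral_finsetSum_measure h3]
  have h7 : ∀ e : Fin N ↪ Fin N, ∫ x, (g x : 𝕜) ∂(Pr.map fun ω i => ξ (e i) ω)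
      = ((∫ ω, g (fun i => ξ i ω) ∂Pr : ℝ) : 𝕜) := by
    intro e
    rw [integral_map (hm e).aemeasurable hgm.aestronglyMeasurable, ← integral_ofReal]
    exact integral_congr_ae (ae_of_all _ fun ω =>
      congrArg (fun r : ℝ => (r : 𝕜)) (hsymm e fun i => ξ i ω))
  simp only [h7]
  simp [Fintype.card_embedding_eq, Nat.descFactorial_self]

/-- The moments of a linear statistic of a biorthogonal ensemble. -/
theorem integral_linearStatistic_pow [SigmaFinite μ] {P Q : ℕ → ℝ → 𝕜}
    (hΞ : IsBiorthogonalEnsemble Pr ξ μ P Q) {f : ℝ → ℝ} (hf : Measurable f)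
    (hint : ∀ n (k l : Fin N), Integrable (fun x => (f x : 𝕜) ^ n * (P k x * Q l x)) μ) (n : ℕ) :
    Integrable (fun ω => linearStatistic ξ f ω ^ n) Pr ∧
    (n.factorial : 𝕜)⁻¹ * ((∫ ω, linearStatistic ξ f ω ^ n ∂Pr : ℝ) : 𝕜)
      = PowerSeries.coeff n (Matrix.of fun i j : Fin N => PowerSeries.mk fun n =>
          (n.factorial : 𝕜)⁻¹ * ∫ x, (f x : 𝕜) ^ n * (P j x * Q i x) ∂μ).det := by
  obtain ⟨h1, h2⟩ := integral_det_mul_pow N hint n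
  have hn : (n.factorial : 𝕜) ≠ 0 := by exact_mod_cast n.factorial_ne_zero
  have hN : (N.factorial : 𝕜) ≠ 0 := by exact_mod_cast N.factorial_ne_zero
  have h3 : ∀ x : Fin N → ℝ, expCoeff 𝕜 (∑ i, (f (x i) : 𝕜)) n
      = (n.factorial : 𝕜)⁻¹ * (((∑ i, f (x i)) ^ n : ℝ) : 𝕜) := by
    intro x
    simp [expCoeff]
  simp only [h3, mul_left_comm _ (n.factorial : 𝕜)⁻¹] at h1 h2
  rw [integrable_const_mul_iff (IsUnit.mk0 _ (inv_ne_zero hn))] at h1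
  obtain ⟨h4, h5⟩ := integral_symmetric hΞ.measurable hΞ.determinantal
    (g := fun x => (∑ i, f (x i)) ^ n) (by fun_prop) (fun e x => by
      congr 1
      exact Equiv.sum_comp (Equiv.ofBijective e (Finite.injective_iff_bijective.1 e.injective))
        fun i => f (x i)) h1
  refine ⟨h4, ?_⟩
  rw [integral_const_mul, ← h5, mul_left_comm] at h2
  exact mul_left_cancel₀ hN h2

end Moments

/-! ### Method of moments for Gaussian limits -/

section Gaussian

/-- The derivative of the remainder of order n + 1 is c times the remainder of order n, so the bound
follows by induction and the mean value inequality. -/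
theorem norm_exp_sub_sum_le_of_nonneg {c : ℂ} (hc : ‖c‖ = 1) (hre : c.re = 0) (n : ℕ) {y : ℝ}
    (hy : 0 ≤ y) :
    ‖Complex.exp (c * y) - ∑ m ∈ Finset.range n, (m.factorial : ℂ)⁻¹ * (c * y) ^ m‖
      ≤ y ^ n / n.factorial := by
  induction n generalizing y with
  | zero => simp [Complex.norm_exp, hre]
  | succ n ih =>
    have hid : ∀ x : ℝ, HasDerivAt (fun x : ℝ => c * (x : ℂ)) c x := fun x => by
      simpa using (Complex.ofRealCLM.hasDerivAt (x := x)).const_mul c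
    have hterm : ∀ (m : ℕ) (x : ℝ),
        HasDerivAt (fun x : ℝ => ((m + 1).factorial : ℂ)⁻¹ * (c * x) ^ (m + 1))
          (c * ((m.factorial : ℂ)⁻¹ * (c * x) ^ m)) x := by
      intro m x
      convert! ((hid x).pow (m + 1)).const_mul ((m + 1).factorial : ℂ)⁻¹ using 1
      have h1 : ((m : ℂ) + 1) ≠ 0 := by exact_mod_cast Nat.succ_ne_zero m
      rw [Nat.factorial_succ, Nat.add_sub_cancel]
      push_cast
      field_simp
    have hd : ∀ x : ℝ, HasDerivAt (fun x : ℝ => Complex.exp (c * x)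
        - ∑ m ∈ Finset.range (n + 1), (m.factorial : ℂ)⁻¹ * (c * x) ^ m)
        (c * (Complex.exp (c * x)
          - ∑ m ∈ Finset.range n, (m.factorial : ℂ)⁻¹ * (c * x) ^ m)) x := by
      intro x
      have h2 : HasDerivAt (fun x : ℝ => ∑ m ∈ Finset.range n,
          ((m + 1).factorial : ℂ)⁻¹ * (c * x) ^ (m + 1))
          (∑ m ∈ Finset.range n, c * ((m.factorial : ℂ)⁻¹ * (c * x) ^ m)) x :=
        HasDerivAt.fun_sum fun m _ => hterm m x
      have h3 := ((hid x).cexp.sub h2).sub_const 1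
      simp only [Finset.sum_range_succ' _ n]
      convert! h3 using 1
      · ext x
        simp
        ring
      · rw [← Finset.mul_sum]; ring
    have hB : ∀ x : ℝ, HasDerivAt (fun x : ℝ => x ^ (n + 1) / (n + 1).factorial)
        (x ^ n / n.factorial) x := by
      intro x
      convert! (hasDerivAt_pow (n + 1) x).div_const ((n + 1).factorial : ℝ) using 1
      have h1 : ((n : ℝ) + 1) ≠ 0 := by exact_mod_cast Nat.succ_ne_zero n
      rw [Nat.factorial_succ, Nat.add_sub_cancel]
      push_cast
      field_simp
    refine image_norm_le_of_norm_deriv_right_le_deriv_boundary (a := 0) (b := y)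
      (fun x _ => (hd x).continuousAt.continuousWithinAt) (fun x _ => (hd x).hasDerivWithinAt)
      ?_ hB (fun x hx => ?_) ⟨hy, le_rfl⟩
    · simp [Finset.sum_range_succ']
    · rw [norm_mul, hc, one_mul]
      exact ih hx.1

theorem norm_exp_mul_I_sub_sum_le (n : ℕ) (y : ℝ) :
    ‖Complex.exp (y * Complex.I)
      - ∑ m ∈ Finset.range n, (m.factorial : ℂ)⁻¹ * (y * Complex.I) ^ m‖
      ≤ |y| ^ n / n.factorial := by
  rcases le_total 0 y with h | h
  · simpa [mul_comm, abs_of_nonneg h] using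
      norm_exp_sub_sum_le_of_nonneg (c := Complex.I) (by simp) (by simp) n h
  · simpa [mul_comm, abs_of_nonpos h] using
      norm_exp_sub_sum_le_of_nonneg (c := -Complex.I) (by simp) (by simp) n (neg_nonneg.2 h)

/-- The coefficients of the power series of `e^{v t² / 2}`. -/
noncomputable def gaussCoeff (v : ℝ) (n : ℕ) : ℝ :=
  if Even n then (v / 2) ^ (n / 2) / (n / 2).factorial else 0

theorem gaussCoeff_add_two (v : ℝ) (n : ℕ) :
    (n + 2) * gaussCoeff v (n + 2) = v * gaussCoeff v n := by
  simp only [gaussCoeff, Nat.even_add, even_two, iff_true]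
  split_ifs with h
  · obtain ⟨r, rfl⟩ := h
    have h1 : (r + r + 2) / 2 = r + 1 := by omega
    have h2 : (r + r) / 2 = r := by omega
    have h3 : ((r : ℝ) + 1) ≠ 0 := by exact_mod_cast Nat.succ_ne_zero r
    rw [h1, h2, Nat.factorial_succ]
    push_cast
    field_simp
    ring
  · simp

/-- The recursion is c' = l c for power series. It expresses the coefficient n + 1 by finitely many
earlier ones, so limits pass through, and for l = vt it is the recursion of e^{vt²/2}. -/
theorem tendsto_gaussCoeff {𝕜 : Type*} [RCLike 𝕜] {c l : ℕ → ℕ → 𝕜} {v : ℝ}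
    (h0 : ∀ᶠ k in atTop, c k 0 = 1)
    (hrec : ∀ᶠ k in atTop, ∀ n, c k (n + 1) * (n + 1)
      = ∑ x ∈ antidiagonal n, l k x.1 * c k x.2)
    (hl : ∀ n, Tendsto (fun k => l k n) atTop (𝓝 (if n = 1 then (v : 𝕜) else 0))) (n : ℕ) :
    Tendsto (fun k => c k n) atTop (𝓝 (gaussCoeff v n : 𝕜)) := by
  induction n using Nat.strong_induction_on with
  | _ n ih =>
    rcases n with _ | n
    · refine tendsto_const_nhds.congr' (h0.mono fun k hk => ?_)
      simp [hk, gaussCoeff]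
    · have hn : ((n : 𝕜) + 1) ≠ 0 := by exact_mod_cast Nat.succ_ne_zero n
      have h1 : Tendsto (fun k => (∑ x ∈ antidiagonal n, l k x.1 * c k x.2) / ((n : 𝕜) + 1)) atTop
          (𝓝 ((∑ x ∈ antidiagonal n, (if x.1 = 1 then (v : 𝕜) else 0) * (gaussCoeff v x.2 : 𝕜))
            / ((n : 𝕜) + 1))) := by
        refine (tendsto_finsetSum _ fun x hx => (hl x.1).mul (ih x.2 ?_)).div_const _
        rw [mem_antidiagonal] at hx
        omega
      have h2 : (∑ x ∈ antidiagonal n, (if x.1 = 1 then (v : 𝕜) else 0) * (gaussCoeff v x.2 : 𝕜))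
          / ((n : 𝕜) + 1) = (gaussCoeff v (n + 1) : 𝕜) := by
        rw [div_eq_iff hn, Finset.Nat.sum_antidiagonal_eq_sum_range_succ_mk]
        simp only [ite_mul, zero_mul]
        rw [Finset.sum_ite_eq']
        rcases n with _ | n
        · simp [gaussCoeff]
        · rw [if_pos (by simp), Nat.add_sub_cancel]
          have := gaussCoeff_add_two v n
          rw [← RCLike.ofReal_mul, ← this]
          push_cast
          ring
      rw [h2] at h1
      refine h1.congr' (hrec.mono fun k hk => ?_)
      rw [← hk n, mul_div_cancel_right₀ _ hn]

/-- The method of moments for centred Gaussian limits. -/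
theorem tendstoInDistribution_of_tendsto_moments {Ω : ℕ → Type*} [∀ k, MeasurableSpace (Ω k)]
    {Pr : ∀ k, Measure (Ω k)} [∀ k, IsProbabilityMeasure (Pr k)] {Y : ∀ k, Ω k → ℝ}
    (hY : ∀ k, Measurable (Y k)) (hint : ∀ k n, Integrable (fun ω => Y k ω ^ n) (Pr k)) {v : ℝ≥0}
    (hlim : ∀ n, Tendsto (fun k => (n.factorial : ℝ)⁻¹ * ∫ ω, Y k ω ^ n ∂(Pr k)) atTop
      (𝓝 (gaussCoeff v n))) :
    TendstoInDistribution Y atTop (id : ℝ → ℝ) Pr (gaussianReal 0 v) where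
  forall_aemeasurable k := (hY k).aemeasurable
  aemeasurable_limit := aemeasurable_id
  tendsto := by
    refine ProbabilityMeasure.tendsto_iff_tendsto_charFun.2 fun θ => ?_
    have hgauss : charFun ((gaussianReal 0 v).map id) θ
        = Complex.exp (((-(v * θ ^ 2 / 2) : ℝ)) : ℂ) := by
      rw [Measure.map_id, charFun_gaussianReal]
      push_cast
      congr 1
      ring
    have hchar : ∀ k, charFun ((Pr k).map (Y k)) θ
        = ∫ ω, Complex.exp (((θ * Y k ω : ℝ) : ℂ) * Complex.I) ∂(Pr k) := by
      intro k
      rw [charFun_apply_real, integral_map (hY k).aemeasurable (by fun_prop)]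
      push_cast
      rfl
    simp only [ProbabilityMeasure.coe_mk, hgauss, hchar]
    have hpoly : ∀ k n ω, ∑ m ∈ Finset.range n, (m.factorial : ℂ)⁻¹
          * (((θ * Y k ω : ℝ) : ℂ) * Complex.I) ^ m
        = ∑ m ∈ Finset.range n, (θ * Complex.I) ^ m
          * (((m.factorial : ℝ)⁻¹ * Y k ω ^ m : ℝ) : ℂ) := by
      intro k n ω
      refine Finset.sum_congr rfl fun m _ => ?_
      push_cast
      ring
    have hterm : ∀ k m, Integrable (fun ω => (θ * Complex.I) ^ m
        * (((m.factorial : ℝ)⁻¹ * Y k ω ^ m : ℝ) : ℂ)) (Pr k) := fun k m =>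
      (((hint k m).const_mul _).ofReal).const_mul _
    -- The Taylor order is even so that the remainder |Y|^{2r} = Y^{2r} is itself a moment.
    have hbound : ∀ k r, ‖(∫ ω, Complex.exp (((θ * Y k ω : ℝ) : ℂ) * Complex.I) ∂(Pr k))
        - ∑ m ∈ Finset.range (2 * r), (θ * Complex.I) ^ m
          * (((m.factorial : ℝ)⁻¹ * ∫ ω, Y k ω ^ m ∂(Pr k) : ℝ) : ℂ)‖
        ≤ θ ^ (2 * r) * (((2 * r).factorial : ℝ)⁻¹ * ∫ ω, Y k ω ^ (2 * r) ∂(Pr k)) := by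
      intro k r
      have h1 : ∑ m ∈ Finset.range (2 * r), (θ * Complex.I) ^ m
          * (((m.factorial : ℝ)⁻¹ * ∫ ω, Y k ω ^ m ∂(Pr k) : ℝ) : ℂ)
          = ∫ ω, ∑ m ∈ Finset.range (2 * r), (m.factorial : ℂ)⁻¹
            * (((θ * Y k ω : ℝ) : ℂ) * Complex.I) ^ m ∂(Pr k) := by
        simp only [hpoly]
        rw [integral_finsetSum _ fun m _ => hterm k m]
        refine Finset.sum_congr rfl fun m _ => ?_
        rw [integral_const_mul, integral_complex_ofReal, integral_const_mul]
      have hexp : Integrable (fun ω => Complex.exp (((θ * Y k ω : ℝ) : ℂ) * Complex.I)) (Pr k) := by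
        refine (integrable_const (1 : ℝ)).mono' ?_ (ae_of_all _ fun ω => ?_)
        · have := hY k
          exact Measurable.aestronglyMeasurable (by fun_prop)
        · rw [Complex.norm_exp_ofReal_mul_I]
      rw [h1, ← integral_sub hexp]
      · rw [← mul_assoc, mul_comm (θ ^ (2 * r)), ← integral_const_mul]
        refine norm_integral_le_of_norm_le ((hint k (2 * r)).const_mul _)
          (ae_of_all _ fun ω => (norm_exp_mul_I_sub_sum_le (2 * r) (θ * Y k ω)).trans_eq ?_)
        rw [(even_two_mul r).pow_abs, mul_pow]
        ring
      · simp only [hpoly]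
        exact integrable_finsetSum _ fun m _ => hterm k m
    -- This is e^{vt²/2} at t = iθ: odd terms vanish and even ones give the exponential series of
    -- -vθ²/2.
    have hS : ∀ r, ∑ m ∈ Finset.range (2 * r), (θ * Complex.I) ^ m * ((gaussCoeff v m : ℝ) : ℂ)
        = ∑ j ∈ Finset.range r, (((-(v * θ ^ 2 / 2) : ℝ)) : ℂ) ^ j / j.factorial := by
      intro r
      induction r with
      | zero => simp
      | succ r ih =>
        have h2 : ¬ Even (2 * r + 1) := by simp
        have h3 : Even (2 * r) := even_two_mul r
        rw [mul_add, mul_one, Finset.sum_range_succ, Finset.sum_range_succ, ih,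
          Finset.sum_range_succ, gaussCoeff, gaussCoeff, if_neg h2, if_pos h3,
          Nat.mul_div_cancel_left _ two_pos, pow_mul (_ : ℂ) 2 r, mul_pow (θ : ℂ), Complex.I_sq]
        push_cast
        rw [mul_zero, add_zero, ← mul_div_assoc, ← mul_pow]
        congr 3
        ring
    have hSlim : Tendsto (fun r => ∑ m ∈ Finset.range (2 * r), (θ * Complex.I) ^ m
        * ((gaussCoeff v m : ℝ) : ℂ)) atTop (𝓝 (Complex.exp (((-(v * θ ^ 2 / 2) : ℝ)) : ℂ))) := by
      simp only [hS]
      rw [Complex.exp_eq_exp_ℂ]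
      exact (NormedSpace.expSeries_div_hasSum_exp (𝔸 := ℂ) _).tendsto_sum_nat
    have htail : Tendsto (fun r => θ ^ (2 * r) * gaussCoeff v (2 * r)) atTop (𝓝 0) := by
      refine (FloorSemiring.tendsto_pow_div_factorial_atTop (v * θ ^ 2 / 2 : ℝ)).congr fun r => ?_
      rw [gaussCoeff, if_pos (even_two_mul r), Nat.mul_div_cancel_left _ two_pos, pow_mul,
        ← mul_div_assoc, ← mul_pow]
      congr 2
      ring
    rw [Metric.tendsto_nhds]
    intro ε hε
    have hε3 : 0 < ε / 3 := by positivity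
    obtain ⟨r, hr1, hr2⟩ := ((Metric.tendsto_nhds.1 hSlim (ε / 3) hε3).and
      (htail.eventually_lt_const hε3)).exists
    have h1 : ∀ᶠ k in atTop, θ ^ (2 * r) * (((2 * r).factorial : ℝ)⁻¹
        * ∫ ω, Y k ω ^ (2 * r) ∂(Pr k)) < ε / 3 :=
      ((hlim (2 * r)).const_mul _).eventually_lt_const hr2
    have h2 : Tendsto (fun k => ∑ m ∈ Finset.range (2 * r), (θ * Complex.I) ^ m
        * (((m.factorial : ℝ)⁻¹ * ∫ ω, Y k ω ^ m ∂(Pr k) : ℝ) : ℂ)) atTop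
        (𝓝 (∑ m ∈ Finset.range (2 * r), (θ * Complex.I) ^ m * ((gaussCoeff v m : ℝ) : ℂ))) :=
      tendsto_finsetSum _ fun m _ =>
        ((Complex.continuous_ofReal.tendsto _).comp (hlim m)).const_mul _
    filter_upwards [h1, Metric.tendsto_nhds.1 h2 (ε / 3) hε3] with k hk1 hk2
    have h3 := dist_triangle4 (∫ ω, Complex.exp (((θ * Y k ω : ℝ) : ℂ) * Complex.I) ∂(Pr k)) _ _ _
      |>.trans_lt (add_lt_add (add_lt_add (((dist_eq_norm _ _).trans_le (hbound k r)).trans_lt hk1)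
        hk2) hr1)
    linarith

end Gaussian

/-! ### Contour integrals as coefficients of F(s) -/

section Symbol

theorem laurentEval_eq_eval₂ (s : LaurentPolynomial ℝ) {z : ℂ} (hz : z ≠ 0) :
    laurentEval s z = LaurentPolynomial.eval₂ (algebraMap ℝ ℂ) (Units.mk0 z hz) s := by
  induction s using LaurentPolynomial.induction_on' with
  | add p q hp hq =>
    rw [map_add, ← hp, ← hq, laurentEval, AddMonoidAlgebra.coeff_add,
      Finsupp.sum_add_index' (by simp) (by intros; push_cast; ring)]
    rfl
  | C_mul_T n a =>
    rw [LaurentPolynomial.eval₂_C_mul_T, ← LaurentPolynomial.single_eq_C_mul_T, laurentEval,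
      AddMonoidAlgebra.coeff_single, Finsupp.sum_single_index (by simp)]
    simp

theorem aeval_laurentEval (F : Polynomial ℝ) (s : LaurentPolynomial ℝ) {z : ℂ} (hz : z ≠ 0) :
    Polynomial.aeval (laurentEval s z) F = laurentEval (Polynomial.aeval s F) z := by
  rw [laurentEval_eq_eval₂ _ hz, laurentEval_eq_eval₂ _ hz, Polynomial.aeval_def,
    Polynomial.aeval_def, Polynomial.hom_eval₂]
  congr 1
  ext r
  simp

theorem symbolCoeff_eq (F : Polynomial ℝ) (s : LaurentPolynomial ℝ) (k : ℤ) :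
    symbolCoeff F s k = (((Polynomial.aeval s F).coeff k : ℝ) : ℂ) := by
  set g := Polynomial.aeval s F
  have h1 : ∮ z in C(0, 1), Polynomial.aeval (laurentEval s z) F * z ^ (-k) / z
      = ∮ z in C(0, 1), ∑ m ∈ g.coeff.support, (g.coeff m : ℂ) * (z - 0) ^ (m - k - 1) := by
    refine circleIntegral.integral_congr zero_le_one fun z hz => ?_
    have hz0 : z ≠ 0 := by
      rintro rfl
      simp at hz
    simp only [sub_zero]
    rw [aeval_laurentEval F s hz0, laurentEval, Finsupp.sum, Finset.sum_mul, Finset.sum_div]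
    refine Finset.sum_congr rfl fun m _ => ?_
    rw [sub_sub, sub_eq_add_neg, neg_add, ← add_assoc, zpow_add₀ hz0, zpow_add₀ hz0, zpow_neg_one]
    ring
  have hint : ∀ m : ℤ, CircleIntegrable (fun z : ℂ => (g.coeff m : ℂ) * (z - 0) ^ (m - k - 1))
      0 1 := by
    intro m
    refine CircleIntegrable.const_smul (a := (g.coeff m : ℂ)) ?_
    rw [circleIntegrable_sub_zpow_iff]
    simp
  have h2 : ∀ m : ℤ, ∮ z in C(0, 1), (g.coeff m : ℂ) * (z - 0) ^ (m - k - 1)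
      = if m = k then (g.coeff m : ℂ) * (2 * π * Complex.I) else 0 := by
    intro m
    rw [circleIntegral.integral_const_mul]
    split_ifs with h
    · subst h
      simp only [sub_self, zero_sub, zpow_neg_one]
      rw [circleIntegral.integral_sub_center_inv 0 one_ne_zero]
    · rw [circleIntegral.integral_sub_zpow_of_ne (by omega), mul_zero]
  rw [symbolCoeff, h1, circleIntegral.integral_fun_sum fun m _ => hint m]
  simp only [h2]
  rw [Finset.sum_ite_eq']
  split_ifs with h
  · have := Complex.two_pi_I_ne_zero
    field_simp
  · rw [Finsupp.notMem_support_iff.1 h]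
    simp

end Symbol

/-! ### The recurrence as multiplication by x -/

section Embedding

variable {𝕜 : Type*} [RCLike 𝕜]

/-- The transpose of a banded matrix indexed by `ℕ`, shifted by `N` to the left and extended by zero
to an operator indexed by `ℤ`. -/
noncomputable def shiftOp (J : Matrix ℕ ℕ 𝕜) (W N : ℕ) : Op 𝕜 :=
  ofCols fun j => Finsupp.onFinset (Finset.Ioo (j - W) (j + W))
    (fun i => if i ∈ Finset.Ioo (j - W) (j + W) ∧ 0 ≤ N + i ∧ 0 ≤ N + j
      then J (N + j).toNat (N + i).toNat else 0)
    fun i hi => by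
      by_contra h
      simp [h] at hi

theorem ent_shiftOp (J : Matrix ℕ ℕ 𝕜) (W N : ℕ) (i j : ℤ) :
    ent (shiftOp J W N) i j = if i ∈ Finset.Ioo (j - W) (j + W) ∧ 0 ≤ N + i ∧ 0 ≤ N + j
      then J (N + j).toNat (N + i).toNat else 0 := by
  rw [shiftOp, ent_ofCols, Finsupp.onFinset_apply]

theorem ent_shiftOp_of_isBanded {J : Matrix ℕ ℕ 𝕜} {W : ℕ} (hJ : IsBanded W J) {N : ℕ} {i j : ℤ}
    (hi : 0 ≤ N + i) (hj : 0 ≤ N + j) :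
    ent (shiftOp J W N) i j = J (N + j).toNat (N + i).toNat := by
  rw [ent_shiftOp]
  split_ifs with h
  · rfl
  · refine (hJ _ _ ?_).symm
    simp only [hi, hj, and_true, Finset.mem_Ioo, not_and_or, not_lt] at h
    rw [Int.toNat_of_nonneg hi, Int.toNat_of_nonneg hj, le_abs]
    omega

theorem hasBand_shiftOp (J : Matrix ℕ ℕ 𝕜) (W N : ℕ) : HasBand W (shiftOp J W N) := by
  intro i j h
  rw [ent_shiftOp, if_neg]
  rintro ⟨h1, -⟩
  rw [Finset.mem_Ioo] at h1
  rw [le_abs] at h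
  omega

theorem shiftOp_mem_lowerBlock (J : Matrix ℕ ℕ 𝕜) (W N : ℕ) :
    shiftOp J W N ∈ lowerBlock 𝕜 N := by
  intro i j hi hj
  rw [ent_shiftOp, if_neg]
  rintro ⟨-, -, h⟩
  omega

/-- The functional `∑ v_i e_i ↦ ∑ v_i P_{N+i}(x)`. -/
noncomputable def evalFun (P : ℕ → ℝ → 𝕜) (N : ℕ) (x : ℝ) : (ℤ →₀ 𝕜) →ₗ[𝕜] 𝕜 :=
  Finsupp.linearCombination 𝕜 fun i : ℤ => if 0 ≤ N + i then P (N + i).toNat x else 0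

theorem evalFun_apply (P : ℕ → ℝ → 𝕜) (N : ℕ) (x : ℝ) {v : ℤ →₀ 𝕜} {S : Finset ℤ}
    (h : v.support ⊆ S) :
    evalFun P N x v = ∑ i ∈ S, v i * if 0 ≤ N + i then P (N + i).toNat x else 0 := by
  rw [evalFun, Finsupp.linearCombination_apply, Finsupp.sum_of_support_subset _ h _ (by simp)]
  rfl

theorem evalFun_shiftOp_apply {P : ℕ → ℝ → 𝕜} {J : Matrix ℕ ℕ 𝕜} (hrec : Recurrence P J) {W : ℕ}
    (hJ : IsBanded W J) (N : ℕ) (x : ℝ) (v : ℤ →₀ 𝕜) :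
    evalFun P N x (shiftOp J W N v) = (x : 𝕜) * evalFun P N x v := by
  have h : (evalFun P N x).comp (shiftOp J W N) = (x : 𝕜) • evalFun P N x := by
    refine Finsupp.lhom_ext' fun j => LinearMap.ext_ring ?_
    have h1 : evalFun P N x (shiftOp J W N (Finsupp.single j 1))
        = ∑ i ∈ Finset.Ioo (j - W) (j + W), ent (shiftOp J W N) i j
          * if 0 ≤ N + i then P (N + i).toNat x else 0 := by
      refine evalFun_apply P N x fun i hi => ?_
      by_contra hi'
      refine Finsupp.mem_support_iff.1 hi ((ent_shiftOp J W N i j).trans (if_neg ?_))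
      exact fun h => hi' h.1
    have h2 : evalFun P N x (Finsupp.single j 1) = if 0 ≤ N + j then P (N + j).toNat x else 0 := by
      simp [evalFun]
    simp only [LinearMap.comp_apply, Finsupp.lsingle_apply, LinearMap.smul_apply, smul_eq_mul]
    rw [h1, h2]
    split_ifs with hj
    · have h3 : HasSum (fun i : ℤ => ent (shiftOp J W N) i j
          * if 0 ≤ N + i then P (N + i).toNat x else 0) ((x : 𝕜) * P (N + j).toNat x) := by
        have hinj : Function.Injective fun k : ℕ => (k : ℤ) - N := fun a b h => by
          simpa using h
        rw [← hinj.hasSum_iff]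
        · convert! hrec x (N + j).toNat using 1
          ext k
          have hk : (N : ℤ) + (k - N) = k := by ring
          simp only [Function.comp_apply]
          rw [ent_shiftOp_of_isBanded hJ (by omega) hj, if_pos (by omega), hk, Int.toNat_natCast]
        · intro i hi
          rw [if_neg, mul_zero]
          exact fun h => hi ⟨(N + i).toNat, by simp only; omega⟩
      refine (hasSum_sum_of_ne_finset_zero fun i hi => ?_).unique h3
      rw [ent_shiftOp, if_neg fun h => hi h.1, zero_mul]
    · rw [mul_zero]
      refine Finset.sum_eq_zero fun i _ => ?_
      rw [ent_shiftOp, if_neg fun h => hj h.2.2, zero_mul]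
  exact LinearMap.congr_fun h v

theorem evalFun_aeval {P : ℕ → ℝ → 𝕜} {N : ℕ} {x : ℝ} {T : Op 𝕜} {c : 𝕜}
    (hT : ∀ v, evalFun P N x (T v) = c * evalFun P N x v) (F : Polynomial 𝕜) (v : ℤ →₀ 𝕜) :
    evalFun P N x (Polynomial.aeval T F v) = F.eval c * evalFun P N x v := by
  have hpow : ∀ (n : ℕ) v, evalFun P N x ((T ^ n) v) = c ^ n * evalFun P N x v := by
    intro n
    induction n with
    | zero => simp
    | succ n ih =>
      intro v
      rw [pow_succ', Module.End.mul_apply, hT, ih, pow_succ']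
      ring
  induction F using Polynomial.induction_on' with
  | add p q hp hq =>
    rw [map_add, LinearMap.add_apply, map_add, hp, hq, Polynomial.eval_add]
    ring
  | monomial n a =>
    rw [Polynomial.aeval_monomial, Module.End.mul_apply, Module.algebraMap_end_apply, map_smul,
      hpow, Polynomial.eval_monomial, smul_eq_mul]
    ring

/-- The operator on shifted indices which corresponds to multiplication by `F(x)`. -/
noncomputable def polyOp (F : Polynomial ℝ) (T : Op 𝕜) : Op 𝕜 :=
  Polynomial.aeval T (F.map (algebraMap ℝ 𝕜))

variable {P Q : ℕ → ℝ → 𝕜} {J : Matrix ℕ ℕ 𝕜} {μ : Measure ℝ}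

/-- The operator F(T)^n represents multiplication by F^n on the P_k. The sum runs over a finite set
independent of x, so it can be integrated term by term against Q_i. -/
theorem eval_pow_mul_eq_sum (hrec : Recurrence P J) {W : ℕ} (hJ : IsBanded W J) (F : Polynomial ℝ)
    (n N j : ℕ) (x : ℝ) :
    ((F.eval x : ℝ) : 𝕜) ^ n * P j x
      = ∑ k ∈ ((polyOp F (shiftOp J W N) ^ n) (Finsupp.single ((j : ℤ) - N) 1)).support,
        ent (polyOp F (shiftOp J W N) ^ n) k (j - N)
          * if 0 ≤ N + k then P (N + k).toNat x else 0 := by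
  have h1 := evalFun_aeval (evalFun_shiftOp_apply hrec hJ N x) ((F.map (algebraMap ℝ 𝕜)) ^ n)
    (Finsupp.single ((j : ℤ) - N) 1)
  have h2 : evalFun P N x (Finsupp.single ((j : ℤ) - N) 1) = P j x := by
    simp [evalFun]
  have h3 : (F.map (algebraMap ℝ 𝕜)).eval (x : 𝕜) = ((F.eval x : ℝ) : 𝕜) :=
    Polynomial.eval_map_apply (f := algebraMap ℝ 𝕜) x
  rw [h2, Polynomial.eval_pow, h3, map_pow] at h1
  rw [← h1]
  exact evalFun_apply P N x subset_rfl

theorem integrable_eval_pow (hf : IsBiorthogonalFamily μ P Q) (hrec : Recurrence P J) {W : ℕ}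
    (hJ : IsBanded W J) (F : Polynomial ℝ) (n k l : ℕ) :
    Integrable (fun x => ((F.eval x : ℝ) : 𝕜) ^ n * (P k x * Q l x)) μ := by
  -- Any shift would serve here; 0 is taken.
  simp only [← mul_assoc, eval_pow_mul_eq_sum hrec hJ F n 0 k, Finset.sum_mul]
  refine integrable_finsetSum _ fun i _ => ?_
  split_ifs
  · simp only [mul_assoc]
    exact (hf.integrable _ _).const_mul _
  · simp

theorem integral_eval_pow (hf : IsBiorthogonalFamily μ P Q) (hrec : Recurrence P J) {W : ℕ}
    (hJ : IsBanded W J) (F : Polynomial ℝ) (n N j i : ℕ) :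
    ∫ x, ((F.eval x : ℝ) : 𝕜) ^ n * (P j x * Q i x) ∂μ
      = ent (polyOp F (shiftOp J W N) ^ n) (i - N) (j - N) := by
  simp only [← mul_assoc, eval_pow_mul_eq_sum hrec hJ F n N j, Finset.sum_mul]
  have h1 : ∀ k : ℤ, Integrable (fun x => ent (polyOp F (shiftOp J W N) ^ n) k (j - N)
      * (if 0 ≤ N + k then P (N + k).toNat x else 0) * Q i x) μ := by
    intro k
    split_ifs
    · simp only [mul_assoc]
      exact (hf.integrable _ _).const_mul _
    · simp
  have h2 : ∀ k : ℤ, ∫ x, ent (polyOp F (shiftOp J W N) ^ n) k (j - N)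
      * (if 0 ≤ N + k then P (N + k).toNat x else 0) * Q i x ∂μ
      = if k = i - N then ent (polyOp F (shiftOp J W N) ^ n) k (j - N) else 0 := by
    intro k
    by_cases hk : 0 ≤ N + k
    · simp only [hk, if_true, mul_assoc]
      rw [integral_const_mul, hf.biorthogonal]
      by_cases hki : k = i - N
      · rw [if_pos (by omega), if_pos hki, mul_one]
      · rw [if_neg (by omega), if_neg hki, mul_zero]
    · simp only [hk, if_false, mul_zero, zero_mul, integral_zero]
      rw [if_neg (by omega)]
  rw [integral_finsetSum _ fun k _ => h1 k, Finset.sum_congr rfl fun k _ => h2 k,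
    Finset.sum_ite_eq']
  split_ifs with h
  · rfl
  · exact (Finsupp.notMem_support_iff.1 h).symm

end Embedding

/-! ### The differential equation for the centred moments -/

section CentredMoments

/-- The centred moments as a convolution. -/
theorem integral_centred_pow {Ω : Type*} [MeasurableSpace Ω] {Pr : Measure Ω} {X : Ω → ℝ}
    (hX : ∀ n, Integrable (fun ω => X ω ^ n) Pr) (m : ℝ) (n : ℕ) :
    Integrable (fun ω => (X ω - m) ^ n) Pr ∧
    (n.factorial : ℝ)⁻¹ * ∫ ω, (X ω - m) ^ n ∂Pr
      = ∑ x ∈ antidiagonal n, ((x.1.factorial : ℝ)⁻¹ * ∫ ω, X ω ^ x.1 ∂Pr)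
        * expCoeff ℝ (-m) x.2 := by
  have hn : (n.factorial : ℝ)⁻¹ ≠ 0 := inv_ne_zero (by exact_mod_cast n.factorial_ne_zero)
  have h1 : ∀ ω, (n.factorial : ℝ)⁻¹ * (X ω - m) ^ n
      = ∑ x ∈ antidiagonal n, ((x.1.factorial : ℝ)⁻¹ * X ω ^ x.1) * expCoeff ℝ (-m) x.2 := by
    intro ω
    have := expCoeff_add (𝕜 := ℝ) (Commute.all (X ω) (-m)) n
    rw [← sub_eq_add_neg] at this
    exact this
  have h2 : ∀ x : ℕ × ℕ, Integrable
      (fun ω => ((x.1.factorial : ℝ)⁻¹ * X ω ^ x.1) * expCoeff ℝ (-m) x.2) Pr := fun x =>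
    ((hX x.1).const_mul _).mul_const _
  constructor
  · rw [← integrable_const_mul_iff (IsUnit.mk0 _ hn)]
    simp only [h1]
    exact integrable_finsetSum _ fun x _ => h2 x
  · rw [← integral_const_mul]
    simp only [h1]
    rw [integral_finsetSum _ fun x _ => h2 x]
    simp only [integral_mul_const, integral_const_mul]

theorem derivative_expSeries {𝕜 : Type*} [Field 𝕜] [CharZero 𝕜] (a : 𝕜) :
    PowerSeries.derivative 𝕜 (expSeries a) = PowerSeries.C a * expSeries a := by
  ext n
  rw [PowerSeries.coeff_derivative, PowerSeries.coeff_C_mul, coeff_expSeries, coeff_expSeries,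
    ← succ_smul_expCoeff_succ, smul_eq_mul, mul_comm]
  push_cast
  rfl

variable {𝕜 : Type*} [RCLike 𝕜] {Ω : Type*} [MeasurableSpace Ω] {Pr : Measure Ω}
  {N : ℕ} {ξ : Fin N → Ω → ℝ} {μ : Measure ℝ} [SigmaFinite μ] {P Q : ℕ → ℝ → 𝕜}
  {J : Matrix ℕ ℕ 𝕜} {W : ℕ}

theorem linearStatistic_moments (hΞ : IsBiorthogonalEnsemble Pr ξ μ P Q) (hrec : Recurrence P J)
    (hJ : IsBanded W J) (F : Polynomial ℝ) (n : ℕ) :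
    Integrable (fun ω => linearStatistic ξ (fun x => F.eval x) ω ^ n) Pr ∧
    (n.factorial : 𝕜)⁻¹ * ((∫ ω, linearStatistic ξ (fun x => F.eval x) ω ^ n ∂Pr : ℝ) : 𝕜)
      = PowerSeries.coeff n (expTrunc (polyOp F (shiftOp J W N)) N).det := by
  have h := integral_linearStatistic_pow hΞ (f := fun x => F.eval x) (by fun_prop)
    (fun n k l => integrable_eval_pow hΞ.family hrec hJ F n k l) n
  refine ⟨h.1, h.2.trans ?_⟩
  congr 2
  ext i j : 3
  simp only [expTrunc, Matrix.of_apply, PowerSeries.coeff_mk, expCoeff, ent_smul]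
  rw [integral_eval_pow hΞ.family hrec hJ F _ N j i]

/-- The recursion for the centred moments of a linear statistic. -/
theorem centred_moments_rec [IsProbabilityMeasure Pr] (hΞ : IsBiorthogonalEnsemble Pr ξ μ P Q)
    (hrec : Recurrence P J) (hJ : IsBanded W J) (F : Polynomial ℝ) {w : ℕ} (hwN : w ≤ N)
    (hw : HasBand w (polyOp F (shiftOp J W N))) {c : ℕ → 𝕜}
    (hc : ∀ n, c n = (((n.factorial : ℝ)⁻¹ * ∫ ω, (linearStatistic ξ (fun x => F.eval x) ω
      - ∫ ω', linearStatistic ξ (fun x => F.eval x) ω' ∂Pr) ^ n ∂Pr : ℝ) : 𝕜)) (n : ℕ) :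
    c (n + 1) * (n + 1)
      = ∑ x ∈ antidiagonal n, traceCoeff w (polyOp F (shiftOp J W N)) x.1 * c x.2 := by
  have hmom := linearStatistic_moments hΞ hrec hJ F
  set X := linearStatistic ξ fun x => F.eval x with hX
  set A := polyOp F (shiftOp J W N) with hA
  set m := ∫ ω, X ω ∂Pr with hm
  set D := (expTrunc A N).det with hD
  set κ := ∑ i : Fin N, ent A (i - N) (i - N) with hκ
  set L : PowerSeries 𝕜 := PowerSeries.mk fun n => traceCoeff w A n with hL
  -- Below -N the operator A acts as the scalar F(0), not as 0, so the block condition is obtained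
  -- from the subalgebra property.
  have hAN : A ∈ lowerBlock 𝕜 N := by
    have h1 := Polynomial.aeval_algHom_apply (lowerBlock 𝕜 N).val
      ⟨shiftOp J W N, shiftOp_mem_lowerBlock J W N⟩ (F.map (algebraMap ℝ 𝕜))
    rw [hA, polyOp]
    change Polynomial.aeval (shiftOp J W N) _ = _ at h1
    rw [h1]
    exact Subtype.prop _
  have hD' : PowerSeries.derivative 𝕜 D = (PowerSeries.C κ + L) * D := by
    rw [hD, derivative_det_expTrunc hAN]
    congr 1
    ext n
    rw [PowerSeries.coeff_mk, sum_ent_logDerivCoeff hw hwN, map_add, PowerSeries.coeff_C, hL,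
      PowerSeries.coeff_mk]
  have hD0 : PowerSeries.coeff 0 D = 1 := by
    rw [← (hmom 0).2]
    simp
  have hL0 : traceCoeff w A 0 = 0 := by
    have : transferCoeff (negProj 𝕜) (expCoeff 𝕜 A) 0 = 0 := by
      rw [transferCoeff_eq, expCoeff_zero, Finset.sum_range_zero, sub_zero, mul_one, sub_mul,
        one_mul, negProj_mul_self, sub_self]
    simp [traceCoeff, this]
  -- Constant terms of D' = (κ + L)D: the left side gives the first moment, and L has constant term
  -- 0.
  have hκm : κ = (m : 𝕜) := by
    have h1 := congrArg (PowerSeries.coeff 0) hD'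
    rw [PowerSeries.coeff_derivative, PowerSeries.coeff_mul, Finset.Nat.antidiagonal_zero,
      Finset.sum_singleton, map_add, hD0, hL, PowerSeries.coeff_mk, hL0, ← (hmom 1).2] at h1
    simpa using h1.symm
  have hΨ : ∀ n, c n = PowerSeries.coeff n (D * expSeries (-κ)) := by
    intro n
    rw [hc, (integral_centred_pow (fun n => (hmom n).1) m n).2, PowerSeries.coeff_mul, RCLike.ofReal_sum]
    refine Finset.sum_congr rfl fun x _ => ?_
    rw [← (hmom x.1).2, coeff_expSeries, hκm]
    simp [expCoeff]
  -- The factor e^{-κt} centres the moments and cancels κ in the logarithmic derivative, leaving the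
  -- window trace alone.
  have hΨ' : PowerSeries.derivative 𝕜 (D * expSeries (-κ)) = L * (D * expSeries (-κ)) := by
    rw [Derivation.leibniz, derivative_expSeries, hD', map_neg]
    simp only [smul_eq_mul]
    ring
  have h2 := congrArg (PowerSeries.coeff n) hΨ'
  rw [PowerSeries.coeff_derivative, PowerSeries.coeff_mul n L] at h2
  simpa only [hΨ, hL, PowerSeries.coeff_mk] using h2

end CentredMoments

/-! ### Passing to the right-limit -/

section RightLimit

variable {𝕜 : Type*} [RCLike 𝕜]

/-- The symbol of the transposed Laurent matrix. -/
noncomputable def transposeSymbol (𝕜 : Type*) [RCLike 𝕜] (s : LaurentPolynomial ℝ) :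
    LaurentPolynomial 𝕜 :=
  LaurentPolynomial.invert (AddMonoidAlgebra.mapRingHom ℤ (algebraMap ℝ 𝕜) s)

theorem coeff_transposeSymbol (s : LaurentPolynomial ℝ) (m : ℤ) :
    (transposeSymbol 𝕜 s).coeff m = ((s.coeff (-m) : ℝ) : 𝕜) := by
  rw [transposeSymbol, LaurentPolynomial.invert_apply, AddMonoidAlgebra.coeff_mapRingHom]

theorem aeval_transposeSymbol (F : Polynomial ℝ) (s : LaurentPolynomial ℝ) :
    Polynomial.aeval (transposeSymbol 𝕜 s) (F.map (algebraMap ℝ 𝕜))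
      = transposeSymbol 𝕜 (Polynomial.aeval s F) := by
  rw [transposeSymbol, transposeSymbol, Polynomial.aeval_algEquiv, AlgHom.comp_apply]
  refine congrArg LaurentPolynomial.invert ?_
  rw [Polynomial.aeval_def, Polynomial.eval₂_map, Polynomial.aeval_def, Polynomial.hom_eval₂]
  congr 1
  ext r : 1
  rw [RingHom.comp_apply, RingHom.comp_apply, LaurentPolynomial.algebraMap_apply,
    LaurentPolynomial.algebraMap_apply, ← LaurentPolynomial.single_eq_C,
    ← LaurentPolynomial.single_eq_C, AddMonoidAlgebra.mapRingHom_single]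
  rfl

/-- Each term pairs d with -d, so the transposition of the symbol does not change the variance. -/
theorem laurentVariance_transposeSymbol (f : LaurentPolynomial ℝ) (K : ℕ) :
    laurentVariance (transposeSymbol 𝕜 f) K = ((laurentVariance f K : ℝ) : 𝕜) := by
  rw [laurentVariance, laurentVariance, RCLike.ofReal_sum]
  refine Finset.sum_congr rfl fun d _ => ?_
  rw [coeff_transposeSymbol, coeff_transposeSymbol, neg_neg]
  push_cast
  ring

theorem hasBand_laurentOp {g : LaurentPolynomial 𝕜} {K : ℤ} :
    HasBand K (laurentOp 𝕜 g) ↔ ∀ m : ℤ, K ≤ |m| → g.coeff m = 0 := by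
  constructor
  · intro h m hm
    have := h m 0 (by rwa [sub_zero])
    rwa [ent_laurentOp, sub_zero] at this
  · intro h i j hij
    rw [ent_laurentOp, h _ hij]

theorem shiftOp_mem_convSubalgebra {J : ℕ → Matrix ℕ ℕ 𝕜} {W : ℕ} (hW : ∀ N, IsBanded W (J N))
    {φ : ℕ → ℕ} (hφ : Tendsto φ atTop atTop) {s : LaurentPolynomial ℝ}
    (hlim : IsRightLimit J φ (laurentMatrix 𝕜 s)) :
    ((fun k => shiftOp (J (φ k)) W (φ k), laurentOp 𝕜 (transposeSymbol 𝕜 s)) :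
      (ℕ → Op 𝕜) × Op 𝕜) ∈ convSubalgebra 𝕜 := by
  obtain ⟨K, hK⟩ := exists_coeff_bound (transposeSymbol 𝕜 s)
  refine ⟨⟨max W K, fun k => (hasBand_shiftOp _ _ _).mono (le_max_left _ _),
    (hasBand_laurentOp.2 hK).mono (le_max_right _ _)⟩, fun i j => ?_⟩
  have h1 := hlim j i
  rw [laurentMatrix, Matrix.of_apply] at h1
  rw [ent_laurentOp, coeff_transposeSymbol, neg_sub]
  refine h1.congr' ?_
  -- For smaller N_k an index may be negative, where `shiftOp` is 0 while `toNat` truncates.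
  filter_upwards [hφ.eventually_ge_atTop (i.natAbs + j.natAbs)] with k hk
  exact (ent_shiftOp_of_isBanded (hW _) (by omega) (by omega)).symm

theorem polyOp_mem_convSubalgebra (F : Polynomial ℝ) {T : ℕ → Op 𝕜} {g : LaurentPolynomial ℝ}
    (h : ((T, laurentOp 𝕜 (transposeSymbol 𝕜 g)) : (ℕ → Op 𝕜) × Op 𝕜) ∈ convSubalgebra 𝕜) :
    ((fun k => polyOp F (T k), laurentOp 𝕜 (transposeSymbol 𝕜 (Polynomial.aeval g F))) :
      (ℕ → Op 𝕜) × Op 𝕜) ∈ convSubalgebra 𝕜 := by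
  have h1 : Polynomial.aeval ((T, laurentOp 𝕜 (transposeSymbol 𝕜 g)) : (ℕ → Op 𝕜) × Op 𝕜)
      (F.map (algebraMap ℝ 𝕜)) ∈ convSubalgebra 𝕜 := by
    have h2 := Polynomial.aeval_algHom_apply (convSubalgebra 𝕜).val ⟨_, h⟩
      (F.map (algebraMap ℝ 𝕜))
    change Polynomial.aeval (T, laurentOp 𝕜 (transposeSymbol 𝕜 g)) _ = _ at h2
    rw [h2]
    exact Subtype.prop _
  convert! h1 using 1
  rw [Polynomial.aeval_prod, AlgHom.prod_apply, Polynomial.aeval_algHom_apply,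
    aeval_transposeSymbol]
  refine Prod.ext (funext fun k => ?_) rfl
  exact Polynomial.aeval_algHom_apply (Pi.evalAlgHom 𝕜 (fun _ : ℕ => Op 𝕜) k) T _

theorem hasSum_symbolCoeff (F : Polynomial ℝ) (s : LaurentPolynomial ℝ) {w : ℕ}
    (hw : ∀ m : ℤ, w ≤ |m| → (Polynomial.aeval s F).coeff m = 0) :
    HasSum (fun k : ℕ => (k : ℂ) * symbolCoeff F s (k : ℤ) * symbolCoeff F s (-(k : ℤ)))
      ((laurentVariance (Polynomial.aeval s F) w : ℝ) : ℂ) := by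
  have h : ((laurentVariance (Polynomial.aeval s F) w : ℝ) : ℂ) = ∑ k ∈ Finset.range w,
      (k : ℂ) * symbolCoeff F s (k : ℤ) * symbolCoeff F s (-(k : ℤ)) := by
    rw [laurentVariance, Complex.ofReal_sum]
    refine Finset.sum_congr rfl fun d _ => ?_
    rw [symbolCoeff_eq, symbolCoeff_eq]
    push_cast
    ring
  rw [h]
  refine hasSum_sum_of_ne_finset_zero fun k hk => ?_
  rw [Finset.mem_range, not_lt] at hk
  rw [symbolCoeff_eq, hw k (by rw [Nat.abs_cast]; exact_mod_cast hk)]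
  simp

end RightLimit

end BOE

/-- Central limit theorem for polynomial linear statistics of biorthogonal ensembles with a banded
recurrence matrix whose right-limit along `N_k = φ k` is a Laurent matrix. -/
theorem mainTheorem1 {𝕜 : Type*} [RCLike 𝕜]
    {Ω : ℕ → Type*} [∀ N, MeasurableSpace (Ω N)]
    (Pr : ∀ N, Measure (Ω N)) [∀ N, IsProbabilityMeasure (Pr N)]
    (ξ : ∀ N, Fin N → Ω N → ℝ)
    (μ : ℕ → Measure ℝ) [∀ N, SigmaFinite (μ N)]
    (P Q : ℕ → ℕ → ℝ → 𝕜)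
    (hΞ : ∀ N, BOE.IsBiorthogonalEnsemble (Pr N) (ξ N) (μ N) (P N) (Q N))
    (J : ℕ → Matrix ℕ ℕ 𝕜)
    (hrec : ∀ N, BOE.Recurrence (P N) (J N))
    (W : ℕ) (hW : ∀ N, BOE.IsBanded W (J N))
    (φ : ℕ → ℕ) (hφ : StrictMono φ)
    (s : LaurentPolynomial ℝ)
    (hlim : BOE.IsRightLimit J φ (BOE.laurentMatrix 𝕜 s))
    (F : Polynomial ℝ) :
    (∀ N, Integrable (BOE.linearStatistic (ξ N) (fun x => F.eval x)) (Pr N)) ∧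
    ∃ v : ℝ≥0,
      HasSum (fun k : ℕ => (k : ℂ) * BOE.symbolCoeff F s (k : ℤ) * BOE.symbolCoeff F s (-(k : ℤ)))
        ((v : ℝ) : ℂ) ∧
      TendstoInDistribution
        (fun (k : ℕ) (ω : Ω (φ k)) =>
          BOE.linearStatistic (ξ (φ k)) (fun x => F.eval x) ω
            - ∫ ω', BOE.linearStatistic (ξ (φ k)) (fun x => F.eval x) ω' ∂(Pr (φ k)))
        atTop (id : ℝ → ℝ) (fun k => Pr (φ k)) (gaussianReal 0 v) := by
  have hlin : ∀ N n, Integrable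
      (fun ω => BOE.linearStatistic (ξ N) (fun x => F.eval x) ω ^ n) (Pr N) := fun N n =>
    (BOE.linearStatistic_moments (hΞ N) (hrec N) (hW N) F n).1
  refine ⟨fun N => by simpa using hlin N 1, ?_⟩
  have hφ' : Tendsto φ atTop atTop := hφ.tendsto_atTop
  have hconv := BOE.polyOp_mem_convSubalgebra F (BOE.shiftOp_mem_convSubalgebra hW hφ' hlim)
  set f := Polynomial.aeval s F with hf
  obtain ⟨⟨w', hw1', hw2'⟩, -⟩ := BOE.mem_convSubalgebra.1 hconv
  -- One w bounds the bands of all the operators and of their limit, so the same window serves for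
  -- every k.
  obtain ⟨w, hw⟩ : ∃ w : ℕ, w' ≤ w := ⟨w'.toNat, Int.self_le_toNat _⟩
  have hw1 := fun k => (hw1' k).mono hw
  have hw2 : BOE.HasBand w (BOE.laurentOp 𝕜 (BOE.transposeSymbol 𝕜 f)) := hw2'.mono hw
  have hft := BOE.hasBand_laurentOp.1 hw2
  have hfw : ∀ m : ℤ, w ≤ |m| → f.coeff m = 0 := by
    intro m hm
    have h1 := hft (-m) (by rwa [abs_neg])
    rw [BOE.coeff_transposeSymbol, neg_neg] at h1
    exact_mod_cast h1
  set Y : ∀ k, Ω (φ k) → ℝ := fun k ω => BOE.linearStatistic (ξ (φ k)) (fun x => F.eval x) ω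
    - ∫ ω', BOE.linearStatistic (ξ (φ k)) (fun x => F.eval x) ω' ∂(Pr (φ k)) with hY
  have hYint : ∀ k n, Integrable (fun ω => Y k ω ^ n) (Pr (φ k)) := fun k n =>
    (BOE.integral_centred_pow (fun n => hlin (φ k) n) _ n).1
  have hYmeas : ∀ k, Measurable (Y k) := by
    intro k
    refine Measurable.sub_const (Finset.measurable_sum _ fun i _ => ?_) _
    exact F.continuous.measurable.comp ((hΞ (φ k)).measurable i)
  set v := BOE.laurentVariance f w with hv
  have hmom : ∀ n, Tendsto (fun k => (n.factorial : ℝ)⁻¹ * ∫ ω, Y k ω ^ n ∂(Pr (φ k))) atTop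
      (𝓝 (BOE.gaussCoeff v n)) := by
    intro n
    have h1 : Tendsto (fun k => (((n.factorial : ℝ)⁻¹ * ∫ ω, Y k ω ^ n ∂(Pr (φ k)) : ℝ) : 𝕜)) atTop
        (𝓝 (BOE.gaussCoeff v n : 𝕜)) := by
      refine BOE.tendsto_gaussCoeff
        (c := fun k n => (((n.factorial : ℝ)⁻¹ * ∫ ω, Y k ω ^ n ∂(Pr (φ k)) : ℝ) : 𝕜))
        (l := fun k n => BOE.traceCoeff w
          (BOE.polyOp F (BOE.shiftOp (J (φ k)) W (φ k))) n) (.of_forall fun k => by simp) ?_ ?_ n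
      -- The window [-w, 0) has to fit into the N_k indices of the ensemble.
      · filter_upwards [hφ'.eventually_ge_atTop w] with k hk n
        exact BOE.centred_moments_rec (hΞ (φ k)) (hrec _) (hW _) F hk (hw1 k) (fun _ => rfl) n
      · intro n
        have h2 := BOE.tendsto_traceCoeff hconv w n
        rwa [BOE.traceCoeff_laurentOp _ hw2 hft, BOE.laurentVariance_transposeSymbol] at h2
    have h3 := (RCLike.continuous_re.tendsto _).comp h1
    simpa only [Function.comp_def, RCLike.ofReal_re] using h3
  -- v / 2 is the limit of the halved variances.
  have hv0 : 0 ≤ v := by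
    have h1 : 0 ≤ BOE.gaussCoeff v 2 := ge_of_tendsto' (hmom 2) fun k =>
      mul_nonneg (by positivity) (integral_nonneg fun ω => sq_nonneg _)
    have h2 : BOE.gaussCoeff v 2 = v / 2 := by simp [BOE.gaussCoeff]
    linarith
  exact ⟨⟨v, hv0⟩, BOE.hasSum_symbolCoeff F s hfw,
    BOE.tendstoInDistribution_of_tendsto_moments hYmeas hYint hmom⟩
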